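/- Let $0<\alpha\le 1$, $T>0$, and let $H$ be a (real or complex) Hilbert space. Let $A\colon D(A)\subset H\to H$ be a densely defined self-adjoint operator with compact resolvent such that, for some $\kappa\ge 0$, $\langle Ax,x\rangle\le\kappa\|x\|^2$ for all $x\in D(A)$. For $u_0\in H$ consider the problem $$\partial_t^\alpha u(t)=Au(t)\quad (0<t<T),\qquad u(0)=u_0,$$ where $\partial_t^\alpha g(t)=\frac{1}{\Gamma(1-\alpha)}\int_0^t (t-s)^{-\alpha}g'(s)\,\mathrm{d}s$ for $0<\alpha<1$ and $\partial_t^1 g=g'$. A solution is a function $u\in C([0,T];H)$ with $u(0)=u_0$ such that for every $v\in D(A)$ the scalar function $t\mapsto\langle u(t),v\rangle$ is absolutely continuous on $[0,b]$ for every $b\in(0,T)$ and $\partial_t^\alpha\langle u,v\rangle(t)=\langle u(t),Av\rangle$ for almost every $t\in(0,T)$. Then there is a constant $M\ge1$, independent of $u_0$ and $u$, such that every solution $u$, for any $u_0\in H$, satisfies $$\|u(t)\|\le M\,\|u_0\|^{1-\frac tT}\,\|u(T)\|^{\frac tT},\qquad 0\le t\le T$$ (with $0^0=1$). Moreover, if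 $\kappa=0$, this holds with $M=1$. -/

import Mathlib

/-- The Caputo derivative `∂_t^α g` of order `0 < α ≤ 1`, with starting point `0`. -/
noncomputable def caputoDeriv {E : Type*} [NormedAddCommGroup E] [NormedSpace ℝ E]
    (α : ℝ) (g : ℝ → E) (t : ℝ) : E :=
  if α = 1 then deriv g t
  else (Real.Gamma (1 - α))⁻¹ • ∫ s in (0 : ℝ)..t, (t - s) ^ (-α) • deriv g s

/-- `R` is the resolvent `(z - A)⁻¹` of the (possibly unbounded) operator `A` at the point `z`:
it is a bounded operator which is a two-sided inverse of `z - A : D(A) → H`. -/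
def IsResolventAt {𝕜 H : Type*} [RCLike 𝕜] [NormedAddCommGroup H] [InnerProductSpace 𝕜 H]
    (A : H →ₗ.[𝕜] H) (z : 𝕜) (R : H →L[𝕜] H) : Prop :=
  (∀ y : H, ∃ h : R y ∈ A.domain, z • R y - A ⟨R y, h⟩ = y) ∧
    ∀ x : A.domain, R (z • (x : H) - A x) = x

/-- `A` has compact resolvent: its resolvent set is nonempty and `(z - A)⁻¹` is a compact operator
for some `z` in it (equivalently for all such `z`, by the resolvent identity). -/
def HasCompactResolvent {𝕜 H : Type*} [RCLike 𝕜] [NormedAddCommGroup H] [InnerProductSpace 𝕜 H]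
    (A : H →ₗ.[𝕜] H) : Prop :=
  ∃ (z : 𝕜) (R : H →L[𝕜] H), IsResolventAt A z R ∧ IsCompactOperator R

/-- `u` is a solution of the Cauchy problem `∂_t^α u = A u` on `(0, T)`, `u(0) = u₀`, for a
self-adjoint operator `A`: `u` is continuous on `[0, T]` with values in `H`, and the equation holds
after pairing with an arbitrary `v ∈ D(A)` (each `⟪v, u⟫` is absolutely continuous, so that its
Caputo derivative is defined by an absolutely convergent integral at almost every time).
For `α = 1` these are the usual weak (equivalently, mild) solutions. Every initial value
`u₀ ∈ H` is allowed, and solutions for which the equation holds in `H` are included. -/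
structure IsFractionalSolution {𝕜 H : Type*} [RCLike 𝕜] [NormedAddCommGroup H]
    [InnerProductSpace 𝕜 H] (α T : ℝ) (A : H →ₗ.[𝕜] H) (u₀ : H) (u : ℝ → H) : Prop where
  continuousOn : ContinuousOn u (Set.Icc 0 T)
  initial : u 0 = u₀
  absolutelyContinuous : ∀ v : A.domain, ∀ b ∈ Set.Ioo 0 T,
    AbsolutelyContinuousOnInterval (fun t => inner 𝕜 (v : H) (u t)) 0 b
  equation : ∀ v : A.domain, ∀ᵐ t ∂MeasureTheory.volume, t ∈ Set.Ioo 0 T →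
    caputoDeriv α (fun s => inner 𝕜 (v : H) (u s)) t = inner 𝕜 (A v) (u t)

/-!
The estimate is an interpolation inequality, and it reduces to scalar functions. An operator
`A ≤ κ` with compact resolvent has an orthonormal basis of eigenvectors `e` with real eigenvalues
`μ ≤ κ` (`exists_hilbertBasis_eigenvectors`). Pairing a solution with `e` gives a scalar solution
of `∂_t^α g = μ g`; fractional integration of order `α` turns this into a Volterra equation with a
unique solution, so `g t = g 0 * w t` with `w t = E_α (μ t^α)`, a Mittag-Leffler function
(`eq_fractionalExp_smul`). If every `w` satisfies `w t ≤ M * w T ^ (t / T)` with the same `M`, then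
Parseval's identity and Hölder's inequality give the estimate in `H`
(`HilbertBasis.norm_le_of_forall_norm_inner_le`).

For `0 ≤ μ ≤ κ` the function `w` takes values in `[1, E_α (κ T^α)]`, so `M = E_α (κ T^α)` works, and
this is `1` for `κ = 0`. For `μ < 0` the inequality holds with constant `1` because `w` is
logarithmically convex (`IsRelaxation.convexOn_log`). This is the heart of the matter. It follows
from the complete monotonicity of `w`, but here it is derived from the equation by a maximum
principle. With `w = 1` on `(-∞, 0]`, the equation takes Marchaud's form
`∫_{-∞}^t (t - s)^{-α-1} (w t - w s) ds = -lam * w t`, where `lam > 0`. The translate `w (· + h)`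
satisfies the same equation for `t > 0`, and therefore the quotient `ρ = w (· + h) / w` has the
property that `ρ t` is, for `t > 0`, an average of the values `ρ s`, `s < t`, with weights
`(t - s)^{-α-1} w s`. As `t` increases, the relative weight of the remote past, where `ρ` is large,
grows, since the kernel is logarithmically convex. So `ρ` increases on `[0, ∞)`
(`IsRelaxation.ratio_monotone`), which for all `h > 0` is logarithmic convexity.
-/

open MeasureTheory Set Filter Topology

/-! ### Logarithmic convexity of relaxation functions -/

section Marchaud

/-- The fractional relaxation equation at time `t`, with the fractional derivative written in
Marchaud's form: `∫_{-∞}^t (t - s)^{-β} (f t - f s) ds = -lam * f t`, the integral being absolutely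
convergent. Here `f` is defined on the whole line and `β` plays the role of `α + 1`. -/
def MarchaudAt (β lam : ℝ) (f : ℝ → ℝ) (t : ℝ) : Prop :=
  IntegrableOn (fun s => (t - s) ^ (-β) * (f t - f s)) (Iio t) ∧
    ∫ s in Iio t, (t - s) ^ (-β) * (f t - f s) = -lam * f t

variable {β lam : ℝ}

lemma MarchaudAt.sub {f g : ℝ → ℝ} {t : ℝ} (hf : MarchaudAt β lam f t)
    (hg : MarchaudAt β lam g t) : MarchaudAt β lam (fun s => f s - g s) t := by
  have e : (fun s => (t - s) ^ (-β) * ((f t - g t) - (f s - g s))) =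
      fun s => (t - s) ^ (-β) * (f t - f s) - (t - s) ^ (-β) * (g t - g s) := by
    ext s; ring
  refine ⟨?_, ?_⟩
  · rw [e]; exact hf.1.sub hg.1
  · rw [e, integral_sub hf.1 hg.1, hf.2, hg.2]; ring

lemma MarchaudAt.const_mul {f : ℝ → ℝ} {t : ℝ} (c : ℝ) (hf : MarchaudAt β lam f t) :
    MarchaudAt β lam (fun s => c * f s) t := by
  have e : (fun s => (t - s) ^ (-β) * (c * f t - c * f s)) =
      fun s => c * ((t - s) ^ (-β) * (f t - f s)) := by
    ext s; ring
  refine ⟨?_, ?_⟩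
  · rw [e]; exact hf.1.const_mul c
  · rw [e, integral_const_mul, hf.2]; ring

lemma MarchaudAt.comp_add {f : ℝ → ℝ} {t h : ℝ} (hf : MarchaudAt β lam f (t + h)) :
    MarchaudAt β lam (fun s => f (s + h)) t := by
  have mp := measurePreserving_add_right (volume : Measure ℝ) h
  have me : MeasurableEmbedding (fun x : ℝ => x + h) :=
    (MeasurableEquiv.addRight h).measurableEmbedding
  have pre : (fun x : ℝ => x + h) ⁻¹' Iio (t + h) = Iio t := by ext; simp
  have e : (fun s => (t - s) ^ (-β) * (f (t + h) - f (s + h))) =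
      (fun s => (t + h - s) ^ (-β) * (f (t + h) - f s)) ∘ (fun x => x + h) := by
    ext s; simp
  refine ⟨?_, ?_⟩
  · rw [e, ← pre, mp.integrableOn_comp_preimage me]; exact hf.1
  · have := mp.setIntegral_preimage_emb me
      (fun s => (t + h - s) ^ (-β) * (f (t + h) - f s)) (Iio (t + h))
    rw [pre, hf.2] at this
    simpa using this

/-- If the value at `t` is the largest up to time `t`, it is nonpositive. -/
lemma MarchaudAt.nonpos_of_forall_le {f : ℝ → ℝ} {t : ℝ} (hlam : 0 < lam)
    (hf : MarchaudAt β lam f t) (hmax : ∀ s < t, f s ≤ f t) : f t ≤ 0 := by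
  have h : 0 ≤ ∫ s in Iio t, (t - s) ^ (-β) * (f t - f s) :=
    setIntegral_nonneg measurableSet_Iio fun s (hs : s < t) =>
      mul_nonneg (Real.rpow_nonneg (by linarith) _) (by linarith [hmax s hs])
  rw [hf.2] at h
  nlinarith

/-- The maximum principle for the relaxation equation with prescribed past. -/
lemma le_of_forall_marchaudAt {f : ℝ → ℝ} {c : ℝ} (hlam : 0 < lam) (hc : 0 ≤ c)
    (hcont : Continuous f) (hpast : ∀ s ≤ 0, f s ≤ c) (hf : ∀ t > 0, MarchaudAt β lam f t)
    (b : ℝ) : f b ≤ c := by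
  by_contra! hb
  have hb0 : 0 < b := by
    by_contra! h
    linarith [hpast b h]
  obtain ⟨t, ht, hmax⟩ := isCompact_Icc.exists_isMaxOn (nonempty_Icc.2 hb0.le)
    hcont.continuousOn
  have hbt : f b ≤ f t := hmax (right_mem_Icc.2 hb0.le)
  have ht0 : 0 < t := by
    refine lt_of_le_of_ne ht.1 fun h => ?_
    have := hpast t h.symm.le
    linarith
  have := (hf t ht0).nonpos_of_forall_le hlam fun s hs => by
    rcases le_or_gt s 0 with h | h
    · linarith [hpast s h]
    · exact hmax ⟨h.le, hs.le.trans ht.2⟩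
  linarith

lemma setIntegral_Iio_pos {f : ℝ → ℝ} {a t : ℝ} (hat : a ≤ t) (hint : IntegrableOn f (Iio t))
    (h0 : ∀ s < t, 0 ≤ f s) (hpos : ∀ s < a, 0 < f s) : 0 < ∫ s in Iio t, f s := by
  rw [setIntegral_pos_iff_support_of_nonneg_ae
    ((ae_restrict_iff' measurableSet_Iio).2 (ae_of_all _ h0)) hint]
  have hsub : Iio a ⊆ Function.support f ∩ Iio t := fun s hs =>
    ⟨(hpos s hs).ne', lt_of_lt_of_le hs hat⟩
  refine lt_of_lt_of_le ?_ (measure_mono hsub)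
  simp

/-- A continuous solution on `(0, ∞)` of the relaxation equation which equals `1` in the past. -/
structure IsRelaxation (β lam : ℝ) (w : ℝ → ℝ) : Prop where
  continuous : Continuous w
  eq_one : ∀ s ≤ 0, w s = 1
  equation : ∀ t > 0, MarchaudAt β lam w t

namespace IsRelaxation

variable {w : ℝ → ℝ}

lemma le_one (hw : IsRelaxation β lam w) (hlam : 0 < lam) (t : ℝ) : w t ≤ 1 :=
  le_of_forall_marchaudAt hlam zero_le_one hw.continuous (fun s hs => (hw.eq_one s hs).le)
    hw.equation t

lemma pos (hw : IsRelaxation β lam w) (hlam : 0 < lam) (t : ℝ) : 0 < w t := by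
  have hnn : ∀ t, 0 ≤ w t := fun t => by
    have := le_of_forall_marchaudAt (f := fun s => -1 * w s) hlam le_rfl
      (continuous_const.mul hw.continuous) (fun s hs => by simp [hw.eq_one s hs])
      (fun t ht => (hw.equation t ht).const_mul (-1)) t
    linarith
  refine lt_of_le_of_ne (hnn t) fun h => ?_
  have ht : 0 < t := by
    by_contra! h'
    rw [hw.eq_one t h'] at h
    norm_num at h
  obtain ⟨h1, h2⟩ := (hw.equation t ht).const_mul (-1)
  have := setIntegral_Iio_pos (a := 0) ht.le h1
    (fun s hs => mul_nonneg (Real.rpow_nonneg (by linarith) _) (by linarith [hnn s]))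
    (fun s hs => mul_pos (Real.rpow_pos_of_pos (by linarith) _) (by
      simp only [hw.eq_one s hs.le, ← h]; norm_num))
  rw [h2] at this
  simp [← h] at this

lemma antitone (hw : IsRelaxation β lam w) (hlam : 0 < lam) : Antitone w := by
  intro x y hxy
  have hh : 0 ≤ y - x := by linarith
  rcases le_or_gt x 0 with hx | hx
  · rw [hw.eq_one x hx]; exact hw.le_one hlam y
  have := le_of_forall_marchaudAt (f := fun s => w (s + (y - x)) - w s) hlam le_rfl
    ((hw.continuous.comp (continuous_add_const _)).sub hw.continuous)
    (fun s hs => by rw [hw.eq_one s hs]; linarith [hw.le_one hlam (s + (y - x))])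
    (fun t ht => (hw.equation _ (by linarith : (0:ℝ) < t + (y - x))).comp_add.sub
      (hw.equation t ht)) x
  simpa using this

/-- If `w (· + h) / w` attains at `t₁` its maximum over `[0, t₁]`, then it stays above this value
afterwards. Write `c` for the value and `d = w (· + h) - c * w`. As `w` decreases, `d ≥ 0` before
some time `a ≤ 0` and `d ≤ 0` on `[a, t₁]`. Replacing the kernel `(t₁ - s)^{-β}` by
`(t₂ - s)^{-β}` with `t₂ > t₁` favours the remote past, where `d ≥ 0`, so the past up to `t₁`
pushes the quotient at `t₂` above `c`. -/
lemma ratio_le_of_forall_le (hw : IsRelaxation β lam w) (hlam : 0 < lam) (hβ : 0 ≤ β)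
    {h t₁ : ℝ} (hh : 0 < h) (ht₁ : 0 ≤ t₁)
    (hmax : ∀ s ∈ Icc 0 t₁, w (s + h) / w s ≤ w (t₁ + h) / w t₁) {t : ℝ} (ht : t₁ ≤ t) :
    w (t₁ + h) / w t₁ ≤ w (t + h) / w t := by
  have wpos := hw.pos hlam
  have anti := hw.antitone hlam
  have rcont : Continuous fun s => w (s + h) / w s :=
    (hw.continuous.comp (continuous_add_const _)).div hw.continuous fun s => (wpos s).ne'
  by_contra! hlt
  -- At the minimum `t₂` of the quotient over `[t₁, t]`, its value is the average of its past.
  obtain ⟨t₂, ht₂, hmin⟩ := isCompact_Icc.exists_isMinOn (nonempty_Icc.2 ht) rcont.continuousOn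
  have hmin' : ∀ s ∈ Icc t₁ t, w (t₂ + h) / w t₂ ≤ w (s + h) / w s := fun s hs => hmin hs
  set c := w (t₁ + h) / w t₁ with hc
  set c₂ := w (t₂ + h) / w t₂ with hc₂
  have hc₂c : c₂ < c := lt_of_le_of_lt (hmin' t (right_mem_Icc.2 ht)) hlt
  have h12 : t₁ < t₂ := lt_of_le_of_ne ht₂.1 fun e => by
    rw [hc, hc₂, e] at hc₂c
    exact lt_irrefl _ hc₂c
  have ht₂0 : 0 < t₂ := lt_of_le_of_lt ht₁ h12
  have hc1 : c ≤ 1 := (div_le_one (wpos _)).2 (anti (by linarith))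
  set d : ℝ → ℝ := fun s => w (s + h) - c * w s with hd
  have marchaud : ∀ (x : ℝ), ∀ t > 0, MarchaudAt β lam (fun s => w (s + h) - x * w s) t :=
    fun x t ht => (hw.equation _ (by linarith : (0:ℝ) < t + h)).comp_add.sub
      ((hw.equation t ht).const_mul x)
  have dt₁ : d t₁ = 0 := by
    have := (wpos t₁).ne'
    simp only [hd, hc]; field_simp; ring
  have dle : ∀ s ∈ Icc 0 t₁, d s ≤ 0 := fun s hs => by
    have := (div_le_iff₀ (wpos s)).1 (hmax s hs)
    simp only [hd]; linarith
  -- Up to `t₁`, the integrand of the equation at `t₂` dominates a function with integral zero: a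
  -- multiple of the integrand of the equation for `d` at `t₁`. There is no equation at time `0`, but
  -- if `t₁ = 0` then `d ≥ 0` on the whole past.
  have key : ∃ ψ : ℝ → ℝ, IntegrableOn ψ (Iio t₁) ∧ ∫ s in Iio t₁, ψ s = 0 ∧
      ∀ s < t₁, ψ s ≤ (t₂ - s) ^ (-β) * d s := by
    have danti : ∀ x y, x ≤ y → y ≤ 0 → d y ≤ d x := fun x y hxy hy => by
      simp only [hd, hw.eq_one y hy, hw.eq_one x (hxy.trans hy)]
      linarith [anti (by linarith : x + h ≤ y + h)]
    rcases ht₁.eq_or_lt with h0 | h0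
    · refine ⟨fun _ => 0, integrableOn_zero, by simp, fun s hs => ?_⟩
      have := danti s t₁ hs.le h0.symm.le
      exact mul_nonneg (Real.rpow_nonneg (by linarith) _) (by linarith)
    · have dcont : Continuous d :=
        (hw.continuous.comp (continuous_add_const _)).sub (continuous_const.mul hw.continuous)
      obtain ⟨a, ha, hda⟩ : (0 : ℝ) ∈ d '' Icc (-h) 0 := by
        refine intermediate_value_Icc' (by linarith) dcont.continuousOn ⟨dle 0 ⟨le_rfl, ht₁⟩, ?_⟩
        simp only [hd, hw.eq_one (-h) (by linarith), neg_add_cancel, hw.eq_one 0 le_rfl]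
        linarith
      obtain ⟨e1, e2⟩ := (marchaud c t₁ h0).const_mul (-1)
      have dt₁' : w (t₁ + h) - c * w t₁ = 0 := dt₁
      simp only [dt₁', mul_zero, zero_sub] at e1 e2
      refine ⟨fun s => ((t₂ - a) / (t₁ - a)) ^ (-β) * ((t₁ - s) ^ (-β) * -(-1 * d s)),
        e1.const_mul _, by rw [integral_const_mul, e2, mul_zero], fun s hs => ?_⟩
      -- The ratio of the two kernels is monotone in `s`; its value at the sign change `a` of `d` is
      -- the multiple to take.
      have ha1 : 0 < t₁ - a := by linarith [ha.2]
      have hs1 : 0 < t₁ - s := by linarith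
      have hs2 : 0 < t₂ - s := by linarith
      have ha2 : 0 < t₂ - a := by linarith
      have split : (t₂ - s) ^ (-β) = ((t₂ - s) / (t₁ - s)) ^ (-β) * (t₁ - s) ^ (-β) := by
        rw [← Real.mul_rpow (by positivity) hs1.le, div_mul_cancel₀ _ hs1.ne']
      have hp : 0 < (t₁ - s) ^ (-β) := Real.rpow_pos_of_pos hs1 _
      rw [split]
      rcases le_or_gt s a with hsa | hsa
      · have hds : 0 ≤ d s := hda ▸ danti s a hsa ha.2
        have : ((t₂ - a) / (t₁ - a)) ^ (-β) ≤ ((t₂ - s) / (t₁ - s)) ^ (-β) := by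
          refine Real.rpow_le_rpow_of_nonpos (by positivity) ?_ (by linarith)
          rw [div_le_div_iff₀ hs1 ha1]
          nlinarith
        have := mul_le_mul_of_nonneg_right this (mul_nonneg hp.le hds)
        linarith
      · have hds : d s ≤ 0 := by
          rcases le_or_gt s 0 with h' | h'
          · exact hda ▸ danti a s hsa.le h'
          · exact dle s ⟨h'.le, hs.le⟩
        have : ((t₂ - s) / (t₁ - s)) ^ (-β) ≤ ((t₂ - a) / (t₁ - a)) ^ (-β) := by
          refine Real.rpow_le_rpow_of_nonpos (by positivity) ?_ (by linarith)
          rw [div_le_div_iff₀ ha1 hs1]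
          nlinarith
        have := mul_le_mul_of_nonneg_right this (mul_nonneg hp.le (neg_nonneg.2 hds))
        linarith
  obtain ⟨ψ, ψint, ψzero, ψle⟩ := key
  obtain ⟨e1, e2⟩ := (marchaud c₂ t₂ ht₂0).const_mul (-1)
  have d₂t₂ : w (t₂ + h) - c₂ * w t₂ = 0 := by
    have := (wpos t₂).ne'
    simp only [hc₂]; field_simp; ring
  simp only [d₂t₂, mul_zero, zero_sub] at e1 e2
  have ψint' : IntegrableOn ((Iio t₁).indicator ψ) (Iio t₂) :=
    ((integrable_indicator_iff measurableSet_Iio).2 ψint).integrableOn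
  have ψzero' : ∫ s in Iio t₂, (Iio t₁).indicator ψ s = 0 := by
    rw [setIntegral_indicator measurableSet_Iio, Iio_inter_Iio, min_eq_right h12.le, ψzero]
  have hp : ∀ s < t₂, 0 < (t₂ - s) ^ (-β) := fun s hs =>
    Real.rpow_pos_of_pos (by linarith) _
  have hlow : ∀ s < t₁, 0 < (t₂ - s) ^ (-β) * -(-1 * (w (s + h) - c₂ * w s)) -
      (Iio t₁).indicator ψ s := fun s hs => by
    rw [indicator_of_mem (show s ∈ Iio t₁ from hs)]
    have h1 := ψle s hs
    have h2 := mul_pos (hp s (hs.trans h12)) (mul_pos (sub_pos.2 hc₂c) (wpos s))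
    simp only [hd] at h1
    linarith
  have := setIntegral_Iio_pos (a := t₁) h12.le (e1.sub ψint') (fun s hs => ?_) hlow
  · simp only [Pi.sub_apply] at this
    rw [integral_sub e1 ψint', e2, ψzero', sub_zero] at this
    exact lt_irrefl _ this
  · rcases lt_or_ge s t₁ with hst | hst
    · exact (hlow s hst).le
    · have := (le_div_iff₀ (wpos s)).1 (hmin' s ⟨hst, hs.le.trans ht₂.2⟩)
      simp only [Pi.sub_apply]
      rw [indicator_of_notMem (by simpa using hst), sub_zero]
      exact mul_nonneg (hp s hs).le (by linarith)

lemma ratio_monotone (hw : IsRelaxation β lam w) (hlam : 0 < lam) (hβ : 0 ≤ β)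
    {h s t : ℝ} (hh : 0 < h) (hs : 0 ≤ s) (hst : s ≤ t) :
    w (s + h) / w s ≤ w (t + h) / w t := by
  have rcont : Continuous fun s => w (s + h) / w s :=
    (hw.continuous.comp (continuous_add_const _)).div hw.continuous fun s => (hw.pos hlam s).ne'
  obtain ⟨t₁, ht₁, hmax⟩ := isCompact_Icc.exists_isMaxOn (nonempty_Icc.2 hs) rcont.continuousOn
  have hmax' : ∀ r ∈ Icc 0 s, w (r + h) / w r ≤ w (t₁ + h) / w t₁ := fun r hr => hmax hr
  exact (hmax' s (right_mem_Icc.2 hs)).trans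
    (hw.ratio_le_of_forall_le hlam hβ hh ht₁.1
      (fun r hr => hmax' r ⟨hr.1, hr.2.trans ht₁.2⟩) (ht₁.2.trans hst))

/-- Relaxation functions are logarithmically convex on `[0, ∞)`. -/
lemma convexOn_log (hw : IsRelaxation β lam w) (hlam : 0 < lam) (hβ : 0 ≤ β)
    (hdiff : ∀ t > 0, DifferentiableAt ℝ w t) :
    ConvexOn ℝ (Ici 0) fun t => Real.log (w t) := by
  have wpos := hw.pos hlam
  have hd : ∀ t > 0, DifferentiableAt ℝ (fun t => Real.log (w t)) t := fun t ht =>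
    (hdiff t ht).log (wpos t).ne'
  have lim : ∀ t > 0, Tendsto (fun h => h⁻¹ * (Real.log (w (t + h)) - Real.log (w t))) (𝓝[>] 0)
      (𝓝 (deriv (fun t => Real.log (w t)) t)) := fun t ht => by
    have := (hasDerivAt_iff_tendsto_slope_zero.1 (hd t ht).hasDerivAt)
    exact this.mono_left (nhdsWithin_mono _ fun x (hx : 0 < x) => hx.ne')
  refine MonotoneOn.convexOn_of_deriv (convex_Ici 0)
    (hw.continuous.log fun t => (wpos t).ne').continuousOn ?_ ?_
  · rw [interior_Ici]
    exact fun t ht => (hd t ht).differentiableWithinAt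
  · rw [interior_Ici]
    intro s hs t ht hst
    refine le_of_tendsto_of_tendsto (lim s hs) (lim t ht) ?_
    filter_upwards [self_mem_nhdsWithin] with h hh
    have := hw.ratio_monotone hlam hβ hh (le_of_lt hs) hst
    have h2 := Real.log_le_log (div_pos (wpos _) (wpos _)) this
    rw [Real.log_div (wpos _).ne' (wpos _).ne', Real.log_div (wpos _).ne' (wpos _).ne'] at h2
    exact mul_le_mul_of_nonneg_left h2 (inv_nonneg.2 (le_of_lt hh))

lemma le_rpow (hw : IsRelaxation β lam w) (hlam : 0 < lam) (hβ : 0 ≤ β)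
    (hdiff : ∀ t > 0, DifferentiableAt ℝ w t) {t T : ℝ} (hT : 0 < T) (ht : t ∈ Icc 0 T) :
    w t ≤ w T ^ (t / T) := by
  have h := (hw.convexOn_log hlam hβ hdiff).2 (mem_Ici.2 le_rfl) (mem_Ici.2 hT.le)
    (sub_nonneg.2 ((div_le_one hT).2 ht.2)) (div_nonneg ht.1 hT.le) (sub_add_cancel 1 (t / T))
  simp only [hw.eq_one 0 le_rfl, Real.log_one, smul_eq_mul, mul_zero, zero_add,
    div_mul_cancel₀ _ hT.ne'] at h
  rw [← Real.log_rpow (hw.pos hlam T)] at h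
  exact (Real.log_le_log_iff (hw.pos hlam t) (Real.rpow_pos_of_pos (hw.pos hlam T) _)).1 h

end IsRelaxation

end Marchaud

/-! ### Mittag-Leffler functions -/

section MittagLeffler

lemma integral_sub_rpow_mul_rpow {p q t : ℝ} (hp : 0 < p) (hq : 0 < q) (ht : 0 < t) :
    ∫ s in (0 : ℝ)..t, (t - s) ^ (p - 1) * s ^ (q - 1) =
      t ^ (p + q - 1) * (Real.Gamma p * Real.Gamma q / Real.Gamma (p + q)) := by
  have h := Complex.betaIntegral_scaled (q : ℂ) (p : ℂ) ht
  have hb : Complex.betaIntegral (q : ℂ) (p : ℂ) =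
      ((Real.Gamma p * Real.Gamma q / Real.Gamma (p + q) : ℝ) : ℂ) := by
    rw [Complex.betaIntegral_eq_Gamma_mul_div _ _ (by simpa) (by simpa)]
    simp only [Complex.ofReal_div, Complex.ofReal_mul, ← Complex.Gamma_ofReal, Complex.ofReal_add]
    rw [mul_comm, add_comm]
  have hl : ∫ s in (0 : ℝ)..t, (s : ℂ) ^ ((q : ℂ) - 1) * ((t : ℂ) - s) ^ ((p : ℂ) - 1) =
      ((∫ s in (0 : ℝ)..t, (t - s) ^ (p - 1) * s ^ (q - 1) : ℝ) : ℂ) := by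
    rw [← intervalIntegral.integral_ofReal]
    refine intervalIntegral.integral_congr fun s hs => ?_
    rw [uIcc_of_le ht.le] at hs
    simp only [Complex.ofReal_mul]
    rw [Complex.ofReal_cpow hs.1, Complex.ofReal_cpow (by linarith [hs.2])]
    push_cast
    ring
  rw [hl, hb] at h
  have e : (t : ℂ) ^ ((q : ℂ) + p - 1) = ((t ^ (p + q - 1) : ℝ) : ℂ) := by
    rw [Complex.ofReal_cpow ht.le]
    push_cast
    rw [add_comm]
  rw [e] at h
  exact_mod_cast h

lemma intervalIntegrable_sub_rpow_mul_rpow {p q t : ℝ} (hp : 0 < p) (hq : 0 < q) (ht : 0 < t) :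
    IntervalIntegrable (fun s => (t - s) ^ (p - 1) * s ^ (q - 1)) volume 0 t := by
  -- A function with nonzero Bochner integral is integrable.
  refine intervalIntegral.intervalIntegrable_of_integral_ne_zero ?_
  rw [integral_sub_rpow_mul_rpow hp hq ht]
  have := Real.Gamma_pos_of_pos hp
  have := Real.Gamma_pos_of_pos hq
  have := Real.Gamma_pos_of_pos (add_pos hp hq)
  positivity

/-- Fractional integration of a generalized power series, term by term. -/
lemma hasSum_fractionalIntegral {p t : ℝ} {c q : ℕ → ℝ} (hp : 0 < p) (hq : ∀ n, 0 < q n)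
    (ht : 0 < t)
    (hsum : Summable fun n => |c n| *
      (t ^ (p + q n - 1) * (Real.Gamma p * Real.Gamma (q n) / Real.Gamma (p + q n)))) :
    HasSum (fun n => c n *
      (t ^ (p + q n - 1) * (Real.Gamma p * Real.Gamma (q n) / Real.Gamma (p + q n))))
      (∫ s in (0 : ℝ)..t, (t - s) ^ (p - 1) * ∑' n, c n * s ^ (q n - 1)) := by
  have hint : ∀ n, Integrable (fun s => c n * ((t - s) ^ (p - 1) * s ^ (q n - 1)))
      (volume.restrict (Ioc 0 t)) := fun n =>
    (((intervalIntegrable_iff_integrableOn_Ioc_of_le ht.le).1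
      (intervalIntegrable_sub_rpow_mul_rpow hp (hq n) ht))).const_mul (c n)
  have hnorm : ∀ n, ∫ s in Ioc 0 t, ‖c n * ((t - s) ^ (p - 1) * s ^ (q n - 1))‖ = |c n| *
      (t ^ (p + q n - 1) * (Real.Gamma p * Real.Gamma (q n) / Real.Gamma (p + q n))) := fun n => by
    rw [← integral_sub_rpow_mul_rpow hp (hq n) ht, intervalIntegral.integral_of_le ht.le,
      ← integral_const_mul]
    refine setIntegral_congr_fun measurableSet_Ioc fun s hs => ?_
    have h1 : 0 ≤ (t - s) ^ (p - 1) := Real.rpow_nonneg (by linarith [hs.2]) _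
    have h2 : 0 ≤ s ^ (q n - 1) := Real.rpow_nonneg hs.1.le _
    simp [abs_of_nonneg h1, abs_of_nonneg h2]
  have := hasSum_integral_of_summable_integral_norm hint (by simpa only [hnorm] using hsum)
  rw [intervalIntegral.integral_of_le ht.le]
  convert! this using 1
  · ext n
    rw [integral_const_mul, ← integral_sub_rpow_mul_rpow hp (hq n) ht,
      intervalIntegral.integral_of_le ht.le]
  · congr 1
    ext s
    rw [← tsum_mul_left]
    congr 1
    ext n
    ring

/-- The one-parameter Mittag-Leffler function `E_α`. -/
noncomputable def mittagLeffler (α x : ℝ) : ℝ := ∑' n : ℕ, x ^ n / Real.Gamma (α * n + 1)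

variable {α : ℝ}

lemma Gamma_mul_add_one_pos (hα : 0 < α) (n : ℕ) : 0 < Real.Gamma (α * n + 1) :=
  Real.Gamma_pos_of_pos (by positivity)

/-- A lower bound for the growth of `Γ` over a step of length `α ≤ 1`, from log-convexity. -/
lemma rpow_mul_Gamma_le (hα : 0 < α) (hα₁ : α ≤ 1) {y : ℝ} (hy : 1 ≤ y) :
    y ^ α * Real.Gamma y ≤ 2 * Real.Gamma (y + α) := by
  have hy0 : 0 < y := by linarith
  have g0 := Real.Gamma_pos_of_pos hy0
  have g1 := Real.Gamma_pos_of_pos (add_pos hy0 hα)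
  have h1 : y * Real.Gamma y ≤ Real.Gamma (y + α) * (y + α) ^ (1 - α) := by
    rcases hα₁.eq_or_lt with rfl | h
    · simp [Real.Gamma_add_one hy0.ne']
    have := Real.Gamma_mul_add_mul_le_rpow_Gamma_mul_rpow_Gamma (s := y + α) (t := y + α + 1)
      (a := α) (b := 1 - α) (by linarith) (by linarith) hα (by linarith) (by ring)
    rw [Real.Gamma_add_one (add_pos hy0 hα).ne', Real.mul_rpow (by linarith) g1.le,
      show α * (y + α) + (1 - α) * (y + α + 1) = y + 1 by ring,
      Real.Gamma_add_one hy0.ne'] at this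
    calc _ ≤ _ := this
      _ = (Real.Gamma (y + α) ^ α * Real.Gamma (y + α) ^ (1 - α)) * (y + α) ^ (1 - α) := by ring
      _ = _ := by rw [← Real.rpow_add g1, add_sub_cancel, Real.rpow_one]
  have h2 : (y + α) ^ (1 - α) ≤ 2 * y ^ (1 - α) := by
    calc (y + α) ^ (1 - α) ≤ (2 * y) ^ (1 - α) :=
          Real.rpow_le_rpow (by linarith) (by linarith) (by linarith)
      _ = 2 ^ (1 - α) * y ^ (1 - α) := Real.mul_rpow (by norm_num) hy0.le
      _ ≤ 2 * y ^ (1 - α) := by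
        gcongr
        calc (2 : ℝ) ^ (1 - α) ≤ 2 ^ (1 : ℝ) :=
              Real.rpow_le_rpow_of_exponent_le (by norm_num) (by linarith)
          _ = 2 := Real.rpow_one 2
  have h3 : y ^ α * y ^ (1 - α) = y := by
    rw [← Real.rpow_add hy0, add_sub_cancel, Real.rpow_one]
  have h4 : 0 < y ^ (1 - α) := Real.rpow_pos_of_pos hy0 _
  refine le_of_mul_le_mul_right ?_ h4
  calc y ^ α * Real.Gamma y * y ^ (1 - α) = y ^ α * y ^ (1 - α) * Real.Gamma y := by ring
    _ = y * Real.Gamma y := by rw [h3]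
    _ ≤ Real.Gamma (y + α) * (y + α) ^ (1 - α) := h1
    _ ≤ Real.Gamma (y + α) * (2 * y ^ (1 - α)) := by gcongr
    _ = _ := by ring

lemma summable_mittagLeffler (hα : 0 < α) (hα₁ : α ≤ 1) (x : ℝ) :
    Summable fun n : ℕ => x ^ n / Real.Gamma (α * n + 1) := by
  rcases eq_or_ne x 0 with rfl | hx
  · refine summable_of_ne_finset_zero (s := {0}) fun n hn => ?_
    simp [zero_pow (by simpa using hn : n ≠ 0)]
  have lim : Tendsto (fun n : ℕ => |x| * 2 * (α * n + 1) ^ (-α)) atTop (𝓝 0) := by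
    have h1 : Tendsto (fun n : ℕ => α * (n : ℝ) + 1) atTop atTop :=
      tendsto_atTop_add_const_right _ _
        (tendsto_natCast_atTop_atTop.const_mul_atTop hα)
    simpa using ((tendsto_rpow_neg_atTop hα).comp h1).const_mul (|x| * 2)
  refine summable_of_ratio_test_tendsto_lt_one zero_lt_one
    (Eventually.of_forall fun n =>
      div_ne_zero (pow_ne_zero _ hx) (Gamma_mul_add_one_pos hα n).ne') ?_
  refine squeeze_zero (fun n => by positivity) (fun n => ?_) lim
  have g0 := Gamma_mul_add_one_pos hα n
  have g1 := Gamma_mul_add_one_pos hα (n + 1)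
  have hy : (1 : ℝ) ≤ α * n + 1 := by
    have : 0 ≤ α * n := by positivity
    linarith
  have key := rpow_mul_Gamma_le hα hα₁ hy
  rw [show α * n + 1 + α = α * ((n + 1 : ℕ) : ℝ) + 1 by push_cast; ring] at key
  have hp : 0 < (α * n + 1) ^ α := Real.rpow_pos_of_pos (by linarith) _
  rw [norm_div, norm_div, Real.norm_of_nonneg g0.le, Real.norm_of_nonneg g1.le, norm_pow,
    norm_pow, Real.norm_eq_abs, Real.rpow_neg (by linarith), pow_succ]
  have hx' : 0 < |x| := abs_pos.2 hx
  field_simp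
  linarith

lemma summable_mittagLeffler_deriv (hα : 0 < α) (hα₁ : α ≤ 1) {x : ℝ} (hx : 1 ≤ x) :
    Summable fun n : ℕ => n * x ^ (n - 1) / Real.Gamma (α * n + 1) := by
  refine Summable.of_nonneg_of_le (fun n => ?_) (fun n => ?_)
    (summable_mittagLeffler hα hα₁ (2 * x))
  · have := Gamma_mul_add_one_pos hα n
    positivity
  · have := Gamma_mul_add_one_pos hα n
    gcongr
    rw [mul_pow]
    gcongr
    · exact_mod_cast Nat.lt_two_pow_self.le
    · exact Nat.sub_le n 1

lemma norm_mittagLeffler_deriv_term_le (hα : 0 < α) {x R : ℝ} (hx : |x| ≤ R) (n : ℕ) :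
    ‖n * x ^ (n - 1) / Real.Gamma (α * n + 1)‖ ≤ n * R ^ (n - 1) / Real.Gamma (α * n + 1) := by
  have := Gamma_mul_add_one_pos hα n
  rw [norm_div, norm_mul, norm_pow, Real.norm_of_nonneg this.le, Real.norm_natCast,
    Real.norm_eq_abs]
  gcongr

lemma hasDerivAt_mittagLeffler (hα : 0 < α) (hα₁ : α ≤ 1) (x : ℝ) :
    HasDerivAt (mittagLeffler α) (∑' n : ℕ, n * x ^ (n - 1) / Real.Gamma (α * n + 1)) x := by
  refine hasDerivAt_tsum_of_isPreconnected
    (g := fun (n : ℕ) (x : ℝ) => x ^ n / Real.Gamma (α * n + 1)) (t := Metric.ball 0 (|x| + 1))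
    (y₀ := 0)
    (summable_mittagLeffler_deriv hα hα₁ (by linarith [abs_nonneg x] : 1 ≤ |x| + 1))
    Metric.isOpen_ball (convex_ball _ _).isPreconnected
    (fun n y _ => (hasDerivAt_pow n y).div_const _) (fun n y hy => ?_)
    (Metric.mem_ball_self (by positivity)) (summable_mittagLeffler hα hα₁ 0) (by simp)
  rw [mem_ball_zero_iff] at hy
  exact norm_mittagLeffler_deriv_term_le hα hy.le n

lemma mittagLeffler_zero : mittagLeffler α 0 = 1 := by
  rw [mittagLeffler, tsum_eq_single 0 fun n hn => by simp [zero_pow hn]]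
  simp

lemma mittagLeffler_mono (hα : 0 < α) (hα₁ : α ≤ 1) {x y : ℝ} (hx : 0 ≤ x) (hxy : x ≤ y) :
    mittagLeffler α x ≤ mittagLeffler α y := by
  refine Summable.tsum_le_tsum (fun n => ?_) (summable_mittagLeffler hα hα₁ x)
    (summable_mittagLeffler hα hα₁ y)
  have := Gamma_mul_add_one_pos hα n
  gcongr

/-- The solution `t ↦ E_α (μ t^α)` of `∂_t^α w = μ w`, `w 0 = 1`, extended by `1` to `t ≤ 0`. -/
noncomputable def fractionalExp (α μ t : ℝ) : ℝ := mittagLeffler α (μ * max t 0 ^ α)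

variable {μ : ℝ}

lemma fractionalExp_of_nonpos (hα : 0 < α) {t : ℝ} (ht : t ≤ 0) : fractionalExp α μ t = 1 := by
  rw [fractionalExp, max_eq_right ht, Real.zero_rpow hα.ne', mul_zero, mittagLeffler_zero]

lemma fractionalExp_of_nonneg {t : ℝ} (ht : 0 ≤ t) :
    fractionalExp α μ t = mittagLeffler α (μ * t ^ α) := by
  rw [fractionalExp, max_eq_left ht]

lemma continuous_fractionalExp (hα : 0 < α) (hα₁ : α ≤ 1) : Continuous (fractionalExp α μ) := by
  have h : Continuous (mittagLeffler α) := continuous_iff_continuousAt.2 fun x =>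
    (hasDerivAt_mittagLeffler hα hα₁ x).continuousAt
  exact h.comp (continuous_const.mul
    ((continuous_id.max continuous_const).rpow_const fun _ => Or.inr hα.le))

lemma fractionalExp_eq_tsum {t : ℝ} (ht : 0 < t) :
    fractionalExp α μ t =
      ∑' n : ℕ, μ ^ n / Real.Gamma (α * n + 1) * t ^ (α * n + 1 - 1) := by
  rw [fractionalExp_of_nonneg ht.le, mittagLeffler]
  congr 1
  ext n
  rw [add_sub_cancel_right, Real.rpow_mul_natCast ht.le, mul_pow]
  ring

lemma hasDerivAt_fractionalExp (hα : 0 < α) (hα₁ : α ≤ 1) {t : ℝ} (ht : 0 < t) :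
    HasDerivAt (fractionalExp α μ)
      ((∑' n : ℕ, n * (μ * t ^ α) ^ (n - 1) / Real.Gamma (α * n + 1)) *
        (μ * (α * t ^ (α - 1)))) t := by
  have h := (hasDerivAt_mittagLeffler hα hα₁ (μ * t ^ α)).comp t
    ((Real.hasDerivAt_rpow_const (p := α) (Or.inl ht.ne')).const_mul μ)
  refine h.congr_of_eventuallyEq ?_
  filter_upwards [lt_mem_nhds ht] with s hs
  exact fractionalExp_of_nonneg hs.le

lemma deriv_fractionalExp_eq_tsum (hα : 0 < α) (hα₁ : α ≤ 1) {t : ℝ} (ht : 0 < t) :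
    deriv (fractionalExp α μ) t =
      ∑' n : ℕ, μ ^ (n + 1) / Real.Gamma (α * (n + 1)) * t ^ (α * (n + 1) - 1) := by
  rw [(hasDerivAt_fractionalExp hα hα₁ ht).deriv]
  have hs : Summable fun n : ℕ => (n : ℝ) * (μ * t ^ α) ^ (n - 1) / Real.Gamma (α * n + 1) :=
    Summable.of_norm_bounded (summable_mittagLeffler_deriv hα hα₁
      (by linarith [abs_nonneg (μ * t ^ α)] : 1 ≤ |μ * t ^ α| + 1)) fun n =>
        norm_mittagLeffler_deriv_term_le hα (by linarith) n
  rw [hs.tsum_eq_zero_add]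
  simp only [Nat.cast_zero, zero_mul, zero_div, zero_add]
  rw [← tsum_mul_right]
  congr 1
  ext n
  have hn : (0 : ℝ) < α * (n + 1) := by positivity
  have g := Real.Gamma_pos_of_pos hn
  have e : t ^ (α * (n + 1) - 1) = (t ^ α) ^ n * t ^ (α - 1) := by
    rw [← Real.rpow_mul_natCast ht.le, ← Real.rpow_add ht]
    congr 1
    ring
  push_cast
  rw [e, Real.Gamma_add_one hn.ne', mul_pow, pow_succ]
  field_simp

/-- The integrated form of the fractional equation `∂_t^α w = μ w`. -/
lemma fractionalExp_volterra (hα : 0 < α) (hα₁ : α ≤ 1) {t : ℝ} (ht : 0 < t) :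
    fractionalExp α μ t =
      1 + μ / Real.Gamma α * ∫ s in (0 : ℝ)..t, (t - s) ^ (α - 1) * fractionalExp α μ s := by
  have gα := Real.Gamma_pos_of_pos hα
  have term : ∀ (x : ℝ) (n : ℕ), x ^ n / Real.Gamma (α * n + 1) * (t ^ (α + (α * n + 1) - 1) *
      (Real.Gamma α * Real.Gamma (α * n + 1) / Real.Gamma (α + (α * n + 1)))) =
      Real.Gamma α * (t ^ α * ((x * t ^ α) ^ n / Real.Gamma (α * ((n + 1 : ℕ) : ℝ) + 1))) :=
    fun x n => by
      have := Gamma_mul_add_one_pos hα n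
      have e : t ^ (α + (α * n + 1) - 1) = t ^ α * (t ^ α) ^ n := by
        rw [← Real.rpow_mul_natCast ht.le, ← Real.rpow_add ht]
        congr 1
        ring
      rw [e, show α + (α * n + 1) = α * ((n + 1 : ℕ) : ℝ) + 1 by push_cast; ring, mul_pow]
      field_simp
  have sum : ∀ x : ℝ, Summable fun n : ℕ =>
      (x * t ^ α) * ((x * t ^ α) ^ n / Real.Gamma (α * ((n + 1 : ℕ) : ℝ) + 1)) := fun x => by
    have := (summable_nat_add_iff 1).2 (summable_mittagLeffler hα hα₁ (x * t ^ α))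
    refine this.congr fun n => ?_
    rw [pow_succ]
    ring
  rcases eq_or_ne μ 0 with rfl | hμ
  · rw [fractionalExp_of_nonneg ht.le]
    simp [mittagLeffler_zero]
  have tα : 0 < t ^ α := Real.rpow_pos_of_pos ht _
  have h := hasSum_fractionalIntegral (p := α) (q := fun n : ℕ => α * n + 1)
    (c := fun n : ℕ => μ ^ n / Real.Gamma (α * n + 1)) hα (fun n => by positivity) ht (by
      have : ∀ n : ℕ, |μ ^ n / Real.Gamma (α * n + 1)| = |μ| ^ n / Real.Gamma (α * n + 1) :=
        fun n => by rw [abs_div, abs_pow, abs_of_pos (Gamma_mul_add_one_pos hα n)]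
      simp only [this, term]
      refine ((sum |μ|).mul_left (Real.Gamma α / |μ|)).congr fun n => ?_
      have := abs_pos.2 hμ
      field_simp)
  simp only [term] at h
  have hint : ∫ s in (0 : ℝ)..t, (t - s) ^ (α - 1) *
      ∑' n : ℕ, μ ^ n / Real.Gamma (α * n + 1) * s ^ (α * n + 1 - 1) =
      ∫ s in (0 : ℝ)..t, (t - s) ^ (α - 1) * fractionalExp α μ s := by
    rw [intervalIntegral.integral_of_le ht.le, intervalIntegral.integral_of_le ht.le]
    refine setIntegral_congr_fun measurableSet_Ioc fun s hs => ?_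
    rw [fractionalExp_eq_tsum hs.1]
  rw [hint] at h
  have h2 := h.mul_left (μ / Real.Gamma α)
  rw [← h2.tsum_eq, fractionalExp_of_nonneg ht.le, mittagLeffler,
    (summable_mittagLeffler hα hα₁ _).tsum_eq_zero_add]
  congr 1
  · simp
  · congr 1
    ext n
    rw [pow_succ]
    field_simp

lemma intervalIntegrable_caputo_fractionalExp (hα : 0 < α) (hα₁ : α < 1) {t : ℝ} (ht : 0 < t) :
    IntervalIntegrable (fun s => (t - s) ^ (-α) * deriv (fractionalExp α μ) s) volume 0 t := by
  set R := |μ| * t ^ α + 1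
  have hR : 1 ≤ R := by
    have : 0 ≤ |μ| * t ^ α := mul_nonneg (abs_nonneg _) (Real.rpow_nonneg ht.le _)
    linarith
  set B := ∑' n : ℕ, n * R ^ (n - 1) / Real.Gamma (α * n + 1)
  have hB := intervalIntegrable_sub_rpow_mul_rpow (sub_pos.2 hα₁) hα ht
  rw [intervalIntegrable_iff_integrableOn_Ioc_of_le ht.le] at hB ⊢
  refine (hB.const_mul (B * (|μ| * α))).mono' ?_ ?_
  · exact (((measurable_const.sub measurable_id).pow_const _).mul
      (measurable_deriv _)).aestronglyMeasurable
  · refine (ae_restrict_iff' measurableSet_Ioc).2 (ae_of_all _ fun s hs => ?_)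
    have h1 : 0 ≤ (t - s) ^ (-α) := Real.rpow_nonneg (by linarith [hs.2]) _
    have h2 : 0 ≤ s ^ (α - 1) := Real.rpow_nonneg hs.1.le _
    have h3 : |μ * s ^ α| ≤ R := by
      rw [abs_mul, abs_of_nonneg (Real.rpow_nonneg hs.1.le α)]
      have : s ^ α ≤ t ^ α := Real.rpow_le_rpow hs.1.le hs.2 hα.le
      have := mul_le_mul_of_nonneg_left this (abs_nonneg μ)
      linarith
    have h4 : ‖∑' n : ℕ, n * (μ * s ^ α) ^ (n - 1) / Real.Gamma (α * n + 1)‖ ≤ B :=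
      tsum_of_norm_bounded (summable_mittagLeffler_deriv hα hα₁.le hR).hasSum
        (norm_mittagLeffler_deriv_term_le hα h3)
    rw [(hasDerivAt_fractionalExp hα hα₁.le hs.1).deriv, show 1 - α - 1 = -α by ring, norm_mul,
      norm_mul, norm_mul, norm_mul, Real.norm_of_nonneg h1, Real.norm_of_nonneg h2,
      Real.norm_of_nonneg hα.le, Real.norm_eq_abs μ]
    calc _ ≤ (t - s) ^ (-α) * (B * (|μ| * (α * s ^ (α - 1)))) := by gcongr
      _ = _ := by ring

/-- `w t = E_α (μ t^α)` satisfies the Caputo equation at every `t > 0`. -/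
lemma fractionalExp_caputo (hα : 0 < α) (hα₁ : α < 1) {t : ℝ} (ht : 0 < t) :
    ∫ s in (0 : ℝ)..t, (t - s) ^ (-α) * deriv (fractionalExp α μ) s =
      μ * Real.Gamma (1 - α) * fractionalExp α μ t := by
  have term : ∀ (x : ℝ) (n : ℕ), x ^ (n + 1) / Real.Gamma (α * (n + 1)) *
      (t ^ (1 - α + α * (n + 1) - 1) * (Real.Gamma (1 - α) * Real.Gamma (α * (n + 1)) /
        Real.Gamma (1 - α + α * (n + 1)))) =
      x * Real.Gamma (1 - α) * ((x * t ^ α) ^ n / Real.Gamma (α * n + 1)) := fun x n => by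
    have hn : (0 : ℝ) < α * (n + 1) := by positivity
    have := Real.Gamma_pos_of_pos hn
    rw [show 1 - α + α * (n + 1) = α * n + 1 by ring, add_sub_cancel_right,
      Real.rpow_mul_natCast ht.le, mul_pow, pow_succ]
    field_simp
  have h := hasSum_fractionalIntegral (p := 1 - α) (q := fun n : ℕ => α * (n + 1))
    (c := fun n : ℕ => μ ^ (n + 1) / Real.Gamma (α * (n + 1))) (sub_pos.2 hα₁)
    (fun n => by positivity) ht (by
      have : ∀ n : ℕ, |μ ^ (n + 1) / Real.Gamma (α * (n + 1))| =
          |μ| ^ (n + 1) / Real.Gamma (α * (n + 1)) := fun n => by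
        have hn : (0 : ℝ) < α * (n + 1) := by positivity
        rw [abs_div, abs_pow, abs_of_pos (Real.Gamma_pos_of_pos hn)]
      simp only [this, term]
      exact (summable_mittagLeffler hα hα₁.le _).mul_left _)
  simp only [term] at h
  rw [fractionalExp_of_nonneg ht.le, mittagLeffler, ← tsum_mul_left, h.tsum_eq,
    intervalIntegral.integral_of_le ht.le, intervalIntegral.integral_of_le ht.le]
  refine setIntegral_congr_fun measurableSet_Ioc fun s hs => ?_
  rw [deriv_fractionalExp_eq_tsum hα hα₁.le hs.1, show 1 - α - 1 = -α by ring]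

/-- From the Caputo to the Marchaud form of the equation, by integration by parts on `(0, t)`. The
past `s ≤ 0`, where the function is `1`, accounts for the boundary term at `0`. -/
lemma marchaudAt_fractionalExp (hα : 0 < α) (hα₁ : α < 1) (lam : ℝ) {t : ℝ} (ht : 0 < t) :
    MarchaudAt (α + 1) (lam * Real.Gamma (1 - α) / α) (fractionalExp α (-lam)) t := by
  set w := fractionalExp α (-lam) with hw
  have wcont : Continuous w := continuous_fractionalExp hα hα₁.le
  have wderiv : ∀ s > 0, HasDerivAt w (deriv w s) s := fun s hs =>
    (hasDerivAt_fractionalExp hα hα₁.le hs).differentiableAt.hasDerivAt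
  -- As `w` is differentiable at `t`, one power of the singularity of the Marchaud integrand at
  -- `s = t` is absorbed by a continuous difference quotient.
  have slope : Continuous (dslope w t) :=
    continuousOn_univ.1 ((continuousOn_dslope univ_mem).2
      ⟨wcont.continuousOn, (wderiv t ht).differentiableAt⟩)
  have slope_eq : ∀ s < t, (t - s) ^ (-(α + 1)) * (w t - w s) = (t - s) ^ (-α) * dslope w t s :=
    fun s hs => by
      have hts : 0 < t - s := by linarith
      rw [dslope_of_ne _ hs.ne, slope_def_field, show -(α + 1) = -α - 1 by ring,
        Real.rpow_sub_one hts.ne', ← neg_sub t s, ← neg_sub (w t) (w s)]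
      field_simp
  have kint : IntervalIntegrable (fun s => (t - s) ^ (-α)) volume 0 t := by
    have := intervalIntegrable_sub_rpow_mul_rpow (sub_pos.2 hα₁) one_pos ht
    simpa using this
  have int1 : IntervalIntegrable (fun s => (t - s) ^ (-(α + 1)) * (w t - w s)) volume 0 t := by
    have h := kint.mul_continuousOn slope.continuousOn
    rw [intervalIntegrable_iff_integrableOn_Ioo_of_le ht.le] at h ⊢
    exact h.congr_fun (fun s hs => (slope_eq s hs.2).symm) measurableSet_Ioo
  have past : ∀ s ≤ 0, (t - s) ^ (-(α + 1)) * (w t - w s) = (t - s) ^ (-(α + 1)) * (w t - 1) :=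
    fun s hs => by rw [hw, fractionalExp_of_nonpos hα hs]
  have mp := Measure.measurePreserving_sub_left (volume : Measure ℝ) t
  have me : MeasurableEmbedding (fun x : ℝ => t - x) :=
    (MeasurableEquiv.subLeft t).measurableEmbedding
  have pre : (fun x : ℝ => t - x) ⁻¹' Ici t = Iic 0 := by ext; simp
  have int0 : IntegrableOn (fun s => (t - s) ^ (-(α + 1))) (Iic 0) := by
    have h := (integrableOn_Ici_iff_integrableOn_Ioi).2
      (integrableOn_Ioi_rpow_of_lt (by linarith : -(α + 1) < -1) ht)
    rwa [← mp.integrableOn_comp_preimage me, pre] at h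
  have val0 : ∫ s in Iic 0, (t - s) ^ (-(α + 1)) = t ^ (-α) / α := by
    have h := mp.setIntegral_preimage_emb me (fun x => x ^ (-(α + 1))) (Ici t)
    rw [pre, integral_Ici_eq_integral_Ioi,
      integral_Ioi_rpow_of_lt (by linarith : -(α + 1) < -1) ht] at h
    rw [h, show -(α + 1) + 1 = -α by ring, neg_div_neg_eq]
  have int0' : IntegrableOn (fun s => (t - s) ^ (-(α + 1)) * (w t - w s)) (Iic 0) :=
    IntegrableOn.congr_fun (int0.mul_const (w t - 1)) (fun s hs => (past s hs).symm) measurableSet_Iic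
  have val0' : ∫ s in Iic 0, (t - s) ^ (-(α + 1)) * (w t - w s) = t ^ (-α) / α * (w t - 1) := by
    rw [setIntegral_congr_fun measurableSet_Iic past, integral_mul_const, val0]
  have int2 := intervalIntegrable_caputo_fractionalExp (μ := -lam) hα hα₁ ht
  have parts := intervalIntegral.integral_eq_sub_of_hasDerivAt_of_tendsto ht
    (f := fun s => (t - s) ^ (-α) * (w s - w t))
    (f' := fun s => (t - s) ^ (-α) * deriv w s - α * ((t - s) ^ (-(α + 1)) * (w t - w s)))
    (fa := t ^ (-α) * (1 - w t)) (fb := 0) (fun s hs => by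
      have hts : 0 < t - s := by linarith [hs.2]
      have h1 : HasDerivAt (fun s => (t - s) ^ (-α)) (-1 * -α * (t - s) ^ (-α - 1)) s :=
        ((hasDerivAt_id s).const_sub t).rpow_const (Or.inl hts.ne')
      refine (h1.mul ((wderiv s hs.1).sub_const (w t))).congr_deriv ?_
      rw [show -α - 1 = -(α + 1) by ring]
      ring) (int2.sub (int1.const_mul α)) (by
      have h : ContinuousAt (fun s => (t - s) ^ (-α) * (w s - w t)) 0 :=
        (ContinuousAt.rpow_const (by fun_prop) (Or.inl (by simpa using ht.ne'))).mul
          (wcont.continuousAt.sub_const _)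
      have h' := h.tendsto.mono_left (nhdsWithin_le_nhds (s := Ioi 0))
      rwa [sub_zero, hw, fractionalExp_of_nonpos hα le_rfl] at h') (by
      have h : Continuous fun s => -((t - s) ^ (1 - α) * dslope w t s) :=
        (((continuous_const.sub continuous_id).rpow_const fun _ =>
          Or.inr (by linarith)).mul slope).neg
      have h' := (h.tendsto t).mono_left (nhdsWithin_le_nhds (s := Iio t))
      rw [sub_self, Real.zero_rpow (by linarith), zero_mul, neg_zero] at h'
      refine h'.congr' ?_
      filter_upwards [self_mem_nhdsWithin] with s (hs : s < t)
      have hts : 0 < t - s := by linarith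
      rw [mul_comm, ← mul_right_inj' (Real.rpow_pos_of_pos hts (-1)).ne']
      have := slope_eq s hs
      rw [show -(α + 1) = -1 + -α by ring, Real.rpow_add hts] at this
      rw [show 1 - α = 1 + -α by ring, Real.rpow_add hts, Real.rpow_one, Real.rpow_neg_one] at *
      field_simp at this ⊢
      linarith)
  rw [intervalIntegral.integral_sub int2 (int1.const_mul α), intervalIntegral.integral_const_mul,
    fractionalExp_caputo hα hα₁ ht, ← hw] at parts
  have split : Iio t = Iic 0 ∪ Ioo 0 t := (Iic_union_Ioo_eq_Iio ht).symm
  have int1' := (intervalIntegrable_iff_integrableOn_Ioo_of_le ht.le).1 int1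
  rw [MarchaudAt, split]
  refine ⟨int0'.union int1', ?_⟩
  rw [setIntegral_union (Iic_disjoint_Ioi le_rfl |>.mono_right Ioo_subset_Ioi_self)
    measurableSet_Ioo int0' int1', val0', ← integral_Ioc_eq_integral_Ioo,
    ← intervalIntegral.integral_of_le ht.le, ← mul_right_inj' hα.ne']
  field_simp
  linarith

lemma isRelaxation_fractionalExp (hα : 0 < α) (hα₁ : α < 1) (lam : ℝ) :
    IsRelaxation (α + 1) (lam * Real.Gamma (1 - α) / α) (fractionalExp α (-lam)) where
  continuous := continuous_fractionalExp hα hα₁.le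
  eq_one _ hs := fractionalExp_of_nonpos hα hs
  equation _ ht := marchaudAt_fractionalExp hα hα₁ lam ht

end MittagLeffler

/-! ### From the Caputo equation to a Volterra equation -/

section AbsolutelyContinuous

variable {𝕜 : Type*} [RCLike 𝕜] {g : ℝ → 𝕜} {a b : ℝ}

lemma AbsolutelyContinuousOnInterval.comp_of_dist_le {X Y : Type*} [PseudoMetricSpace X]
    [PseudoMetricSpace Y] {f : ℝ → X} {φ : X → Y} (hf : AbsolutelyContinuousOnInterval f a b)
    (hφ : ∀ x y, dist (φ x) (φ y) ≤ dist x y) :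
    AbsolutelyContinuousOnInterval (fun t => φ (f t)) a b :=
  squeeze_zero (fun _ => Finset.sum_nonneg fun _ _ => dist_nonneg)
    (fun _ => Finset.sum_le_sum fun _ _ => hφ _ _) hf

lemma AbsolutelyContinuousOnInterval.re (hg : AbsolutelyContinuousOnInterval g a b) :
    AbsolutelyContinuousOnInterval (fun t => RCLike.re (g t)) a b :=
  hg.comp_of_dist_le fun x y => by
    rw [Real.dist_eq, dist_eq_norm, ← map_sub]
    exact RCLike.abs_re_le_norm _

lemma AbsolutelyContinuousOnInterval.im (hg : AbsolutelyContinuousOnInterval g a b) :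
    AbsolutelyContinuousOnInterval (fun t => RCLike.im (g t)) a b :=
  hg.comp_of_dist_le fun x y => by
    rw [Real.dist_eq, dist_eq_norm, ← map_sub]
    exact RCLike.abs_im_le_norm _

lemma AbsolutelyContinuousOnInterval.ae_deriv_eq (hg : AbsolutelyContinuousOnInterval g a b) :
    ∀ᵐ t, t ∈ uIcc a b → deriv g t =
      ((deriv (fun t => RCLike.re (g t)) t : ℝ) : 𝕜) + ((deriv (fun t => RCLike.im (g t)) t : ℝ) : 𝕜) *
        RCLike.I := by
  filter_upwards [hg.re.ae_differentiableAt, hg.im.ae_differentiableAt] with t h1 h2 ht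
  have h1' := (RCLike.ofRealCLM (K := 𝕜)).hasFDerivAt.comp_hasDerivAt t (h1 ht).hasDerivAt
  have h2' := (RCLike.ofRealCLM (K := 𝕜)).hasFDerivAt.comp_hasDerivAt t (h2 ht).hasDerivAt
  have h := h1'.add (h2'.mul_const (RCLike.I : 𝕜))
  have e : g = (RCLike.ofRealCLM (K := 𝕜) ∘ fun t => RCLike.re (g t)) +
      fun t => (RCLike.ofRealCLM (K := 𝕜) ∘ fun t => RCLike.im (g t)) t * RCLike.I := by
    ext t
    simp [RCLike.re_add_im]
  rw [← e] at h
  simpa using h.deriv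

lemma AbsolutelyContinuousOnInterval.intervalIntegrable_deriv_rclike
    (hg : AbsolutelyContinuousOnInterval g a b) : IntervalIntegrable (deriv g) volume a b := by
  have h1 : IntervalIntegrable (fun t => ((deriv (fun t => RCLike.re (g t)) t : ℝ) : 𝕜)) volume a b :=
    ⟨hg.re.intervalIntegrable_deriv.1.ofReal, hg.re.intervalIntegrable_deriv.2.ofReal⟩
  have h2 : IntervalIntegrable (fun t => ((deriv (fun t => RCLike.im (g t)) t : ℝ) : 𝕜)) volume a b :=
    ⟨hg.im.intervalIntegrable_deriv.1.ofReal, hg.im.intervalIntegrable_deriv.2.ofReal⟩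
  refine (h1.add (h2.mul_const RCLike.I)).congr_ae ?_
  refine (ae_restrict_iff' measurableSet_uIoc).2 ?_
  filter_upwards [hg.ae_deriv_eq] with t h ht
  exact (h (uIoc_subset_uIcc ht)).symm

lemma AbsolutelyContinuousOnInterval.integral_deriv_eq_sub_rclike
    (hg : AbsolutelyContinuousOnInterval g a b) : ∫ t in a..b, deriv g t = g b - g a := by
  have i1 := hg.re.intervalIntegrable_deriv
  have i2 := hg.im.intervalIntegrable_deriv
  have h1 : IntervalIntegrable (fun t => ((deriv (fun t => RCLike.re (g t)) t : ℝ) : 𝕜))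
      volume a b := ⟨i1.1.ofReal, i1.2.ofReal⟩
  have h2 : IntervalIntegrable (fun t => ((deriv (fun t => RCLike.im (g t)) t : ℝ) : 𝕜))
      volume a b := ⟨i2.1.ofReal, i2.2.ofReal⟩
  have c1 := (RCLike.ofRealCLM (K := 𝕜)).intervalIntegral_comp_comm i1
  have c2 := (RCLike.ofRealCLM (K := 𝕜)).intervalIntegral_comp_comm i2
  simp only [RCLike.ofRealCLM_apply] at c1 c2
  rw [intervalIntegral.integral_congr_ae
      (by filter_upwards [hg.ae_deriv_eq] with t h ht using h (uIoc_subset_uIcc ht)),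
    intervalIntegral.integral_add h1 (h2.mul_const _), intervalIntegral.integral_mul_const,
    c1, c2, hg.re.integral_deriv_eq_sub, hg.im.integral_deriv_eq_sub]
  conv_rhs => rw [← RCLike.re_add_im (g b), ← RCLike.re_add_im (g a)]
  push_cast
  ring

end AbsolutelyContinuous

section FractionalIntegral

variable {E : Type*} [NormedAddCommGroup E] [NormedSpace ℝ E] {α : ℝ}

/-- Kernel integral behind the composition of fractional integrals of orders `α` and `1 - α`. -/
lemma integral_kernel_mul_kernel (hα : 0 < α) (hα₁ : α < 1) {r t : ℝ} (hrt : r < t) :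
    IntegrableOn (fun s => (t - s) ^ (α - 1) * (s - r) ^ (-α)) (Ioc r t) ∧
    ∫ s in Ioc r t, (t - s) ^ (α - 1) * (s - r) ^ (-α) =
      Real.Gamma α * Real.Gamma (1 - α) := by
  have e : (fun s => (t - s) ^ (α - 1) * (s - r) ^ (-α)) =
      fun s => (fun x => (t - r - x) ^ (α - 1) * x ^ (1 - α - 1)) (s - r) := by
    ext s
    simp only
    rw [show t - r - (s - r) = t - s by ring, show 1 - α - 1 = -α by ring]
  have ht : 0 < t - r := by linarith
  have hi := (intervalIntegrable_sub_rpow_mul_rpow hα (sub_pos.2 hα₁) ht).comp_sub_right r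
  have hv := intervalIntegral.integral_comp_sub_right (a := r) (b := t)
    (fun x => (t - r - x) ^ (α - 1) * x ^ (1 - α - 1)) r
  rw [sub_self, integral_sub_rpow_mul_rpow hα (sub_pos.2 hα₁) ht] at hv
  rw [zero_add, sub_add_cancel] at hi
  rw [← intervalIntegrable_iff_integrableOn_Ioc_of_le hrt.le, e,
    ← intervalIntegral.integral_of_le hrt.le]
  refine ⟨hi, hv.trans ?_⟩
  simp

/-- The fractional integral of order `α` inverts the one of order `1 - α` up to an ordinary
integral. -/
lemma fractionalIntegral_fractionalIntegral [CompleteSpace E] (hα : 0 < α) (hα₁ : α < 1) {t : ℝ}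
    (ht : 0 < t) {f : ℝ → E} (hf : IntervalIntegrable f volume 0 t) :
    ∫ s in (0 : ℝ)..t, (t - s) ^ (α - 1) • ∫ r in (0 : ℝ)..s, (s - r) ^ (-α) • f r =
      (Real.Gamma α * Real.Gamma (1 - α)) • ∫ r in (0 : ℝ)..t, f r := by
  rw [intervalIntegrable_iff_integrableOn_Ioc_of_le ht.le] at hf
  set ν := volume.restrict (Ioc 0 t) with hν
  -- The kernel on the triangle `r < s ≤ t`; Fubini's theorem applies to `K s r • f r`.
  set K : ℝ → ℝ → ℝ := fun s r => (Ioi r).indicator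
    (fun s => (t - s) ^ (α - 1) * (s - r) ^ (-α)) s with hK
  have hKmeas : Measurable (Function.uncurry K) := by
    have : Function.uncurry K = {p : ℝ × ℝ | p.2 < p.1}.indicator
        fun p => (t - p.1) ^ (α - 1) * (p.1 - p.2) ^ (-α) := by
      ext ⟨s, r⟩
      simp [hK, indicator]
    rw [this]
    exact (((measurable_const.sub measurable_fst).pow_const _).mul
      ((measurable_fst.sub measurable_snd).pow_const _)).indicator
      (measurableSet_lt measurable_snd measurable_fst)
  have inter : ∀ r ∈ Ioc 0 t, Ioi r ∩ Ioc 0 t = Ioc r t := fun r hr => by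
    ext s
    exact ⟨fun h => ⟨h.1, h.2.2⟩, fun h => ⟨h.1, hr.1.trans h.1, h.2⟩⟩
  have Kint : ∀ r ∈ Ioo 0 t, Integrable (fun s => K s r) ν := fun r hr => by
    rw [hK, integrable_indicator_iff measurableSet_Ioi, IntegrableOn, hν,
      Measure.restrict_restrict measurableSet_Ioi, inter r (Ioo_subset_Ioc_self hr)]
    exact (integral_kernel_mul_kernel hα hα₁ hr.2).1
  have Kval : ∀ r ∈ Ioo 0 t, ∫ s, K s r ∂ν = Real.Gamma α * Real.Gamma (1 - α) := fun r hr => by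
    rw [hK, integral_indicator measurableSet_Ioi, hν, Measure.restrict_restrict measurableSet_Ioi,
      inter r (Ioo_subset_Ioc_self hr)]
    exact (integral_kernel_mul_kernel hα hα₁ hr.2).2
  have Knn : ∀ r, ∀ s ≤ t, 0 ≤ K s r := fun r s hs =>
    indicator_apply_nonneg fun (h : r < s) => mul_nonneg (Real.rpow_nonneg (by linarith) _)
      (Real.rpow_nonneg (by linarith) _)
  have hle : ∀ᵐ s ∂ν, s ≤ t :=
    (ae_restrict_iff' measurableSet_Ioc).2 (ae_of_all _ fun s hs => hs.2)
  have hIoo : ∀ᵐ r ∂ν, r ∈ Ioo 0 t := by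
    rw [hν, ← Measure.restrict_congr_set Ioo_ae_eq_Ioc]
    exact ae_restrict_mem measurableSet_Ioo
  have hint : Integrable (Function.uncurry fun s r => K s r • f r) (ν.prod ν) := by
    have hmeas : AEStronglyMeasurable (Function.uncurry fun s r => K s r • f r) (ν.prod ν) :=
      hKmeas.aestronglyMeasurable.smul (hf.aestronglyMeasurable.comp_snd)
    rw [integrable_prod_iff' hmeas]
    refine ⟨?_, ?_⟩
    · filter_upwards [hIoo] with r hr
      exact (Kint r hr).smul_const (f r)
    · refine (hf.norm.const_mul (Real.Gamma α * Real.Gamma (1 - α))).congr ?_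
      filter_upwards [hIoo] with r hr
      rw [← Kval r hr, ← integral_mul_const]
      refine integral_congr_ae ?_
      filter_upwards [hle] with s hs
      simp [norm_smul, abs_of_nonneg (Knn r s hs)]
  have swap := integral_integral_swap hint
  rw [intervalIntegral.integral_of_le ht.le, intervalIntegral.integral_of_le ht.le,
    ← integral_smul]
  calc _ = ∫ s, ∫ r, K s r • f r ∂ν ∂ν := by
        refine setIntegral_congr_fun measurableSet_Ioc fun s hs => ?_
        have e : ∀ r, K s r • f r = (t - s) ^ (α - 1) •
            (Iio s).indicator (fun r => (s - r) ^ (-α) • f r) r := fun r => by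
          by_cases h : r < s
          · simp [hK, h, mul_smul]
          · simp [hK, h]
        simp only [e]
        rw [integral_smul, integral_indicator measurableSet_Iio, hν,
          Measure.restrict_restrict measurableSet_Iio,
          show Iio s ∩ Ioc 0 t = Ioo 0 s by
            ext r
            exact ⟨fun h => ⟨h.2.1, h.1⟩, fun h => ⟨h.2, h.1, h.2.le.trans hs.2⟩⟩,
          intervalIntegral.integral_of_le hs.1.le, integral_Ioc_eq_integral_Ioo]
    _ = _ := swap.trans ?_
  refine integral_congr_ae ?_
  filter_upwards [hIoo] with r hr
  rw [integral_smul_const, Kval r hr]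

/-- A linear Volterra equation with weakly singular kernel has only the trivial solution: compare
the maximum of `e^{-Nt} ‖d t‖` with itself for large `N`. -/
lemma eq_zero_of_volterra (hα : 0 < α) {b c : ℝ} {d : ℝ → E}
    (hd : ContinuousOn d (Icc 0 b))
    (heq : ∀ t ∈ Icc 0 b, d t = c • ∫ s in (0 : ℝ)..t, (t - s) ^ (α - 1) • d s) :
    ∀ t ∈ Icc 0 b, d t = 0 := by
  intro t ht
  have gα := Real.Gamma_pos_of_pos hα
  -- The weighted kernel then has mass `|c| Γ(α) N^{-α} ≤ 1 / 2`.
  set N : ℝ := (|c| * Real.Gamma α * 2 + 1) ^ (1 / α) with hN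
  have hbase : 0 < |c| * Real.Gamma α * 2 + 1 := by positivity
  have hN0 : 0 < N := Real.rpow_pos_of_pos hbase _
  have hNα : N ^ α = |c| * Real.Gamma α * 2 + 1 := by
    rw [hN, ← Real.rpow_mul hbase.le, one_div_mul_cancel hα.ne', Real.rpow_one]
  obtain ⟨t₀, ht₀, hmax⟩ := isCompact_Icc.exists_isMaxOn ⟨t, ht⟩
    (((Real.continuous_exp.comp (continuous_const.mul continuous_id)).continuousOn
      (s := Icc 0 b)).mul hd.norm : ContinuousOn (fun s => Real.exp (-N * s) * ‖d s‖) (Icc 0 b))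
  set m := Real.exp (-N * t₀) * ‖d t₀‖ with hm
  have hm0 : 0 ≤ m := by positivity
  have bound : ∀ s ∈ Icc 0 b, ‖d s‖ ≤ m * Real.exp (N * s) := fun s hs => by
    have h : Real.exp (-N * s) * ‖d s‖ ≤ m := hmax hs
    rw [neg_mul, Real.exp_neg, inv_mul_le_iff₀ (Real.exp_pos _)] at h
    linarith
  have gint : IntegrableOn (fun r => r ^ (α - 1) * Real.exp (-(N * r))) (Ioi 0) := by
    refine MeasureTheory.Integrable.of_integral_ne_zero ?_
    rw [Real.integral_rpow_mul_exp_neg_mul_Ioi hα hN0]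
    positivity
  have gval := Real.integral_rpow_mul_exp_neg_mul_Ioi hα hN0
  have gint' : IntervalIntegrable (fun r => r ^ (α - 1) * Real.exp (-(N * r))) volume 0 t₀ :=
    (intervalIntegrable_iff_integrableOn_Ioc_of_le ht₀.1).2 (gint.mono_set Ioc_subset_Ioi_self)
  have e : (fun s => (t₀ - s) ^ (α - 1) * (m * Real.exp (N * s))) = fun s =>
      (m * Real.exp (N * t₀)) *
        (fun r => r ^ (α - 1) * Real.exp (-(N * r))) (t₀ - s) := by
    ext s
    simp only
    rw [show N * s = N * t₀ + -(N * (t₀ - s)) by ring, Real.exp_add]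
    ring
  have hint : IntervalIntegrable (fun s => (t₀ - s) ^ (α - 1) * (m * Real.exp (N * s)))
      volume 0 t₀ := by
    rw [e]
    have := (gint'.comp_sub_left t₀).symm
    rw [sub_self, sub_zero] at this
    exact this.const_mul _
  have hval : ∫ s in (0 : ℝ)..t₀, (t₀ - s) ^ (α - 1) * (m * Real.exp (N * s)) ≤
      m * Real.exp (N * t₀) * ((1 / N) ^ α * Real.Gamma α) := by
    rw [e, intervalIntegral.integral_const_mul, intervalIntegral.integral_comp_sub_left
      (fun r => r ^ (α - 1) * Real.exp (-(N * r))), sub_self, sub_zero, ← gval,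
      intervalIntegral.integral_of_le ht₀.1]
    gcongr
    · refine (ae_restrict_iff' measurableSet_Ioi).2 (ae_of_all _ fun r (hr : 0 < r) => ?_)
      exact mul_nonneg (Real.rpow_nonneg hr.le _) (Real.exp_pos _).le
    · exact Ioc_subset_Ioi_self
  have h1 : ‖d t₀‖ ≤ |c| * (m * Real.exp (N * t₀) * ((1 / N) ^ α * Real.Gamma α)) := by
    rw [heq t₀ ht₀, norm_smul, Real.norm_eq_abs]
    gcongr
    refine (intervalIntegral.norm_integral_le_of_norm_le ht₀.1 (ae_of_all _ fun s hs => ?_)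
      hint).trans hval
    have : 0 ≤ (t₀ - s) ^ (α - 1) := Real.rpow_nonneg (by linarith [hs.2]) _
    rw [norm_smul, Real.norm_of_nonneg this]
    gcongr
    exact bound s ⟨hs.1.le, hs.2.trans ht₀.2⟩
  have h2 : m ≤ |c| * Real.Gamma α / (|c| * Real.Gamma α * 2 + 1) * m := by
    calc m ≤ Real.exp (-N * t₀) *
          (|c| * (m * Real.exp (N * t₀) * ((1 / N) ^ α * Real.Gamma α))) := by
            rw [hm] at h1 ⊢
            gcongr
      _ = (Real.exp (-N * t₀) * Real.exp (N * t₀)) *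
          (|c| * m * ((1 / N) ^ α * Real.Gamma α)) := by ring
      _ = _ := by
        rw [← Real.exp_add, neg_mul, neg_add_cancel, Real.exp_zero,
          Real.div_rpow zero_le_one hN0.le, hNα, Real.one_rpow]
        ring
  have h3 : |c| * Real.Gamma α / (|c| * Real.Gamma α * 2 + 1) ≤ 1 / 2 := by
    rw [div_le_div_iff₀ hbase (by norm_num)]
    linarith
  have h4 : m = 0 := le_antisymm (by nlinarith) hm0
  have h5 := bound t ht
  rw [h4, zero_mul] at h5
  exact norm_le_zero_iff.1 h5

end FractionalIntegral

section Scalar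

variable {𝕜 : Type*} [RCLike 𝕜] {α : ℝ}

lemma volterra_of_caputo (hα : 0 < α) (hα₁ : α ≤ 1) {μ t : ℝ} (ht : 0 ≤ t) {g : ℝ → 𝕜}
    (hg : AbsolutelyContinuousOnInterval g 0 t)
    (heq : ∀ᵐ s, s ∈ Ioc 0 t → caputoDeriv α g s = μ • g s) :
    g t = g 0 + (μ / Real.Gamma α) • ∫ s in (0 : ℝ)..t, (t - s) ^ (α - 1) • g s := by
  rcases ht.eq_or_lt with rfl | ht
  · simp
  rw [← uIoc_of_le ht.le] at heq
  have ftc := hg.integral_deriv_eq_sub_rclike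
  rw [← sub_eq_iff_eq_add', ← ftc]
  rcases hα₁.eq_or_lt with rfl | hα₁
  · simp only [caputoDeriv, if_true] at heq
    rw [intervalIntegral.integral_congr_ae heq, intervalIntegral.integral_smul]
    simp
  have gα := Real.Gamma_pos_of_pos hα
  have gα' := Real.Gamma_pos_of_pos (sub_pos.2 hα₁)
  have h := fractionalIntegral_fractionalIntegral hα hα₁ ht hg.intervalIntegrable_deriv_rclike
  have h' : ∫ s in (0 : ℝ)..t, (t - s) ^ (α - 1) • ∫ r in (0 : ℝ)..s, (s - r) ^ (-α) • deriv g r =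
      ∫ s in (0 : ℝ)..t, (Real.Gamma (1 - α) * μ) • ((t - s) ^ (α - 1) • g s) := by
    refine intervalIntegral.integral_congr_ae ?_
    filter_upwards [heq] with s hs hst
    have := hs hst
    rw [caputoDeriv, if_neg hα₁.ne, inv_smul_eq_iff₀ gα'.ne'] at this
    rw [this, smul_comm, mul_smul, smul_comm μ]
  rw [h', intervalIntegral.integral_smul] at h
  rw [← inv_smul_smul₀ (mul_pos gα gα').ne' (∫ s in (0 : ℝ)..t, deriv g s), ← h, smul_smul]
  congr 1
  field_simp

/-- Solutions of the scalar fractional equation are multiples of `E_α (μ t^α)`. -/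
lemma eq_fractionalExp_smul (hα : 0 < α) (hα₁ : α ≤ 1) {μ T : ℝ} (hT : 0 < T) {g : ℝ → 𝕜}
    (hcont : ContinuousOn g (Icc 0 T))
    (hac : ∀ b ∈ Ioo 0 T, AbsolutelyContinuousOnInterval g 0 b)
    (heq : ∀ᵐ s, s ∈ Ioo 0 T → caputoDeriv α g s = μ • g s) :
    ∀ t ∈ Icc 0 T, g t = fractionalExp α μ t • g 0 := by
  have wcont : Continuous (fractionalExp α μ) := continuous_fractionalExp hα hα₁
  have before : ∀ b ∈ Ioo 0 T, g b = fractionalExp α μ b • g 0 := fun b hb => by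
    have kint : ∀ t ∈ Icc 0 b, IntervalIntegrable (fun s => (t - s) ^ (α - 1)) volume 0 t :=
      fun t ht => by
        rcases ht.1.eq_or_lt with rfl | h
        · simp
        · simpa using intervalIntegrable_sub_rpow_mul_rpow hα one_pos h
    have gcont : ContinuousOn g (Icc 0 b) := hcont.mono (Icc_subset_Icc_right hb.2.le)
    have wcont' : Continuous fun s => fractionalExp α μ s • g 0 := wcont.smul continuous_const
    have := eq_zero_of_volterra (c := μ / Real.Gamma α) hα
      (gcont.sub wcont'.continuousOn) (fun t ht => ?_) b (right_mem_Icc.2 hb.1.le)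
    · exact sub_eq_zero.1 this
    have hsub : uIcc 0 t ⊆ Icc 0 b := by
      rw [uIcc_of_le ht.1]
      exact Icc_subset_Icc_right ht.2
    have h1 := volterra_of_caputo hα hα₁ ht.1 ((hac b hb).mono (by
      rwa [uIcc_of_le hb.1.le])) (by
        filter_upwards [heq] with s hs hst
        exact hs ⟨hst.1, lt_of_le_of_lt (hst.2.trans ht.2) hb.2⟩)
    have h2 : fractionalExp α μ t • g 0 = g 0 +
        (μ / Real.Gamma α) • ∫ s in (0 : ℝ)..t, (t - s) ^ (α - 1) • (fractionalExp α μ s • g 0) := by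
      have : fractionalExp α μ t = 1 + μ / Real.Gamma α *
          ∫ s in (0 : ℝ)..t, (t - s) ^ (α - 1) * fractionalExp α μ s := by
        rcases ht.1.eq_or_lt with rfl | h
        · simp [fractionalExp_of_nonpos hα]
        · exact fractionalExp_volterra hα hα₁ h
      rw [this, add_smul, one_smul, mul_smul, ← intervalIntegral.integral_smul_const]
      simp only [mul_smul]
    have i1 := (kint t ht).smul_continuousOn (gcont.mono hsub)
    have i2 := (kint t ht).smul_continuousOn (wcont'.continuousOn (s := uIcc 0 t))
    simp only [Pi.sub_apply, smul_sub]
    rw [intervalIntegral.integral_sub i1 i2, smul_sub]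
    nth_rewrite 1 [h1, h2]
    abel
  intro t ht
  rcases ht.1.eq_or_lt with rfl | h0
  · rw [fractionalExp_of_nonpos hα le_rfl, one_smul]
  rcases ht.2.eq_or_lt with rfl | h1
  · have lim1 : Tendsto g (𝓝[<] t) (𝓝 (g t)) :=
      ((hcont t ht).mono Ioo_subset_Icc_self).tendsto.mono_left
        (nhdsWithin_Ioo_eq_nhdsLT hT).symm.le
    have lim2 : Tendsto g (𝓝[<] t) (𝓝 (fractionalExp α μ t • g 0)) := by
      refine (((wcont.smul continuous_const).tendsto t).mono_left nhdsWithin_le_nhds).congr' ?_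
      filter_upwards [Ioo_mem_nhdsLT hT] with s hs
      exact (before s hs).symm
    exact tendsto_nhds_unique lim1 lim2
  · exact before t ⟨h0, h1⟩

end Scalar

/-! ### Eigenvector expansion -/

section Spectral

variable {𝕜 H : Type*} [RCLike 𝕜] [NormedAddCommGroup H] [InnerProductSpace 𝕜 H]
  {A : H →ₗ.[𝕜] H}

/-- If `c - A` is injective, then `c` belongs to the resolvent set of an operator with compact
resolvent: by the Fredholm alternative `(c - A) (z - A)⁻¹ = 1 + (c - z) (z - A)⁻¹` is invertible. -/
lemma HasCompactResolvent.exists_isResolventAt [CompleteSpace H] (hA : HasCompactResolvent A)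
    {c : 𝕜} (hc : ∀ x : A.domain, c • (x : H) - A x = 0 → (x : H) = 0) :
    ∃ R : H →L[𝕜] H, IsResolventAt A c R ∧ IsCompactOperator R := by
  obtain ⟨z, R, ⟨hR, hR'⟩, hcomp⟩ := hA
  rcases eq_or_ne c z with rfl | hcz
  · exact ⟨R, ⟨hR, hR'⟩, hcomp⟩
  have hcz' : c - z ≠ 0 := sub_ne_zero.2 hcz
  have hRc : ∀ y, ∃ h : R y ∈ A.domain, c • R y - A ⟨R y, h⟩ = y + (c - z) • R y := fun y => by
    obtain ⟨h, e⟩ := hR y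
    refine ⟨h, ?_⟩
    rw [eq_comm, ← sub_eq_zero]
    nth_rewrite 1 [← e]
    rw [sub_smul]
    abel
  have hres := (hcomp.hasEigenvalue_or_mem_resolventSet
    (μ := -(c - z)⁻¹) (neg_ne_zero.2 (inv_ne_zero hcz'))).resolve_left fun hev => by
    obtain ⟨v, hv⟩ := hev.exists_hasEigenvector
    have e : R v = -(c - z)⁻¹ • v := hv.apply_eq_smul
    obtain ⟨h, e'⟩ := hRc v
    have h0 : R v = 0 := hc ⟨R v, h⟩ (by
      rw [e', e, smul_smul, mul_neg, mul_inv_cancel₀ hcz', neg_one_smul, add_neg_cancel])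
    rw [h0, eq_comm, smul_eq_zero] at e
    exact e.elim (neg_ne_zero.2 (inv_ne_zero hcz')) hv.2
  rw [spectrum.mem_resolventSet_iff] at hres
  obtain ⟨u, hu⟩ := hres
  set S : H →L[𝕜] H := (↑u⁻¹ : H →L[𝕜] H) with hS
  -- `(-(c - z)⁻¹ - R) S = 1`
  have hSy : ∀ y, S y + (c - z) • R (S y) = -(c - z) • y := fun y => by
    have h1 : (u : H →L[𝕜] H) (S y) = y := by
      rw [← mul_apply_eq_comp, hS, Units.mul_inv]
      rfl
    rw [hu] at h1
    simp only [sub_apply, ContinuousLinearMap.algebraMap_apply] at h1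
    conv_rhs => rw [← h1]
    rw [smul_sub, smul_smul, neg_mul_neg, mul_inv_cancel₀ hcz', one_smul, neg_smul, sub_neg_eq_add]
  have main : ∀ y, ∃ h : (-(c - z)⁻¹ • (R ∘L S)) y ∈ A.domain,
      c • (-(c - z)⁻¹ • (R ∘L S)) y - A ⟨(-(c - z)⁻¹ • (R ∘L S)) y, h⟩ = y := fun y => by
    obtain ⟨h, e⟩ := hRc (S y)
    refine ⟨A.domain.smul_mem _ h, ?_⟩
    have : (⟨(-(c - z)⁻¹ • (R ∘L S)) y, A.domain.smul_mem _ h⟩ : A.domain) =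
        -(c - z)⁻¹ • ⟨R (S y), h⟩ := rfl
    rw [this, A.map_smul]
    simp only [smul_apply, ContinuousLinearMap.comp_apply]
    rw [smul_comm, ← smul_sub, e, hSy, smul_smul, neg_mul_neg, inv_mul_cancel₀ hcz', one_smul]
  refine ⟨_, ⟨main, fun x => ?_⟩, (hcomp.comp_clm S).smul _⟩
  obtain ⟨h, e⟩ := main (c • (x : H) - A x)
  have := hc (⟨_, h⟩ - x) (by
    rw [A.map_sub, AddSubgroupClass.coe_sub, smul_sub, sub_sub_sub_comm, e, sub_self])
  exact sub_eq_zero.1 this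

universe u

/-- Spectral theorem for an injective compact symmetric operator, with a Hilbert basis. -/
lemma exists_hilbertBasis_eigenvectors_of_isSymmetric {𝕜 : Type u} {H : Type*} [RCLike 𝕜]
    [NormedAddCommGroup H] [InnerProductSpace 𝕜 H] [CompleteSpace H] {R : H →L[𝕜] H}
    (hRc : IsCompactOperator R) (Rsymm : (R : H →ₗ[𝕜] H).IsSymmetric)
    (Rinj : ∀ x, R x = 0 → x = 0) :
    ∃ (ι : Type u) (b : HilbertBasis ι 𝕜 H) (ν : ι → 𝕜), ∀ i, R (b i) = ν i • b i := by
  have fin : ∀ ν : 𝕜, FiniteDimensional 𝕜 (Module.End.eigenspace (R : H →ₗ[𝕜] H) ν) := fun ν => by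
    rcases eq_or_ne ν 0 with rfl | hν
    · have : Module.End.eigenspace (R : H →ₗ[𝕜] H) 0 = ⊥ := by
        rw [Submodule.eq_bot_iff]
        intro x hx
        rw [Module.End.mem_eigenspace_iff, zero_smul] at hx
        exact Rinj x hx
      rw [this]
      infer_instance
    · exact ContinuousLinearMap.finite_dimensional_eigenspace hRc ν hν
  set v : (Σ ν : 𝕜, Fin (Module.finrank 𝕜 (Module.End.eigenspace (R : H →ₗ[𝕜] H) ν))) → H :=
    fun a => (stdOrthonormalBasis 𝕜 (Module.End.eigenspace (R : H →ₗ[𝕜] H) a.1) a.2 : H) with hv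
  have von : Orthonormal 𝕜 v := Rsymm.orthogonalFamily_eigenspaces.orthonormal_sigma_orthonormal
    fun ν => (stdOrthonormalBasis 𝕜 _).orthonormal
  have vbot : (Submodule.span 𝕜 (range v))ᗮ = ⊥ := by
    rw [eq_bot_iff, ← ContinuousLinearMap.orthogonalComplement_iSup_eigenspaces_eq_bot hRc Rsymm]
    refine Submodule.orthogonal_le (iSup_le fun ν x hx => ?_)
    have h := (stdOrthonormalBasis 𝕜 (Module.End.eigenspace (R : H →ₗ[𝕜] H) ν)).sum_repr ⟨x, hx⟩
    have h' := congrArg (Subtype.val) h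
    rw [AddSubmonoidClass.coe_finsetSum] at h'
    simp only at h'
    rw [← h']
    exact Submodule.sum_mem _ fun i _ =>
      Submodule.smul_mem _ _ (Submodule.subset_span ⟨⟨ν, i⟩, rfl⟩)
  refine ⟨_, HilbertBasis.mkOfOrthogonalEqBot von vbot, fun a => a.1, fun a => ?_⟩
  rw [HilbertBasis.coe_mkOfOrthogonalEqBot]
  exact Module.End.mem_eigenspace_iff.1
    (stdOrthonormalBasis 𝕜 (Module.End.eigenspace (R : H →ₗ[𝕜] H) a.1) a.2).2

/-- Spectral theorem: a self-adjoint operator with compact resolvent which is bounded above has an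
orthonormal basis of eigenvectors. -/
lemma exists_hilbertBasis_eigenvectors {𝕜 : Type u} {H : Type*} [RCLike 𝕜]
    [NormedAddCommGroup H] [InnerProductSpace 𝕜 H] [CompleteSpace H] {A : H →ₗ.[𝕜] H}
    {κ : ℝ} (hA : IsSelfAdjoint A)
    (hbound : ∀ x : A.domain, RCLike.re (inner 𝕜 (A x) (x : H)) ≤ κ * ‖(x : H)‖ ^ 2)
    (hcompact : HasCompactResolvent A) :
    ∃ (ι : Type u) (b : HilbertBasis ι 𝕜 H) (μ : ι → ℝ), ∀ i, μ i ≤ κ ∧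
      ∃ h : b i ∈ A.domain, A ⟨b i, h⟩ = (μ i : 𝕜) • b i := by
  have symm : ∀ x y : A.domain, inner 𝕜 (A x) (y : H) = inner 𝕜 (x : H) (A y) := by
    have h := LinearPMap.adjoint_isFormalAdjoint hA.dense_domain
    rwa [LinearPMap.isSelfAdjoint_def.1 hA] at h
  -- Any `c > κ` lies in the resolvent set, and a real one has a symmetric resolvent.
  set c : ℝ := κ + 1 with hcdef
  have inj : ∀ x : A.domain, (c : 𝕜) • (x : H) - A x = 0 → (x : H) = 0 := fun x hx => by
    have h := hbound x
    rw [← sub_eq_zero.1 hx, inner_smul_left, RCLike.conj_ofReal, inner_self_eq_norm_sq_to_K,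
      ← RCLike.ofReal_pow, ← RCLike.ofReal_mul, RCLike.ofReal_re] at h
    have : ‖(x : H)‖ ^ 2 = 0 := le_antisymm (by linarith) (sq_nonneg _)
    simpa using this
  obtain ⟨R, ⟨hR, hR'⟩, hRc⟩ := hcompact.exists_isResolventAt inj
  have Rsymm : (R : H →ₗ[𝕜] H).IsSymmetric := fun x y => by
    obtain ⟨hx, ex⟩ := hR x
    obtain ⟨hy, ey⟩ := hR y
    have h := symm ⟨R x, hx⟩ ⟨R y, hy⟩
    change inner 𝕜 (R x) y = inner 𝕜 x (R y)
    conv_lhs => rw [← ey]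
    conv_rhs => rw [← ex]
    rw [inner_sub_left, inner_sub_right, h, inner_smul_left, inner_smul_right, RCLike.conj_ofReal]
  have Rinj : ∀ x, R x = 0 → x = 0 := fun x hx => by
    obtain ⟨h, e⟩ := hR x
    have h0 : (⟨R x, h⟩ : A.domain) = 0 := Subtype.ext hx
    rw [h0, hx, LinearPMap.map_zero, smul_zero, sub_zero] at e
    exact e.symm
  obtain ⟨ι, b, ν, hν⟩ := exists_hilbertBasis_eigenvectors_of_isSymmetric hRc Rsymm Rinj
  refine ⟨ι, b, fun i => RCLike.re ((c : 𝕜) - (ν i)⁻¹), fun i => ?_⟩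
  have hva := hν i
  have hv1 : ‖b i‖ = 1 := b.orthonormal.1 i
  have ha : ν i ≠ 0 := fun h => by
    rw [h, zero_smul] at hva
    rw [Rinj _ hva, norm_zero] at hv1
    exact zero_ne_one hv1
  obtain ⟨h, e⟩ := hR (b i)
  have hdom : b i ∈ A.domain := by
    rw [hva] at h
    exact (A.domain.smul_mem_iff ha).1 h
  have hAv : A ⟨b i, hdom⟩ = ((c : 𝕜) - (ν i)⁻¹) • b i := by
    have h1 : (⟨R (b i), h⟩ : A.domain) = ν i • ⟨b i, hdom⟩ := Subtype.ext hva
    rw [h1, hva, A.map_smul, smul_comm, ← smul_sub] at e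
    have h2 : (c : 𝕜) • b i - A ⟨b i, hdom⟩ = (ν i)⁻¹ • b i := by
      rw [eq_inv_smul_iff₀ ha, e]
    rw [sub_smul, ← h2]
    abel
  have real : ((RCLike.re ((c : 𝕜) - (ν i)⁻¹) : ℝ) : 𝕜) = (c : 𝕜) - (ν i)⁻¹ := by
    have h1 := symm ⟨b i, hdom⟩ ⟨b i, hdom⟩
    rw [hAv, inner_smul_left, inner_smul_right, inner_self_eq_norm_sq_to_K, hv1] at h1
    simp only [RCLike.ofReal_one, one_pow, mul_one] at h1
    exact RCLike.conj_eq_iff_re.1 h1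
  refine ⟨?_, hdom, by rw [real, hAv]⟩
  have h1 := hbound ⟨b i, hdom⟩
  rw [hAv, ← real, inner_smul_left, RCLike.conj_ofReal, inner_self_eq_norm_sq_to_K, hv1,
    RCLike.ofReal_one, one_pow, one_pow, mul_one, mul_one, RCLike.ofReal_re] at h1
  exact h1

end Spectral

/-! ### Interpolation inequalities -/

section Interpolation

lemma HilbertBasis.hasSum_norm_sq {ι 𝕜 H : Type*} [RCLike 𝕜] [NormedAddCommGroup H]
    [InnerProductSpace 𝕜 H] (b : HilbertBasis ι 𝕜 H) (x : H) :
    HasSum (fun i => ‖inner 𝕜 (b i) x‖ ^ 2) (‖x‖ ^ 2) := by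
  have h := RCLike.hasSum_re 𝕜 (b.hasSum_inner_mul_inner x x)
  convert! h using 1
  · ext i
    rw [← inner_conj_symm, RCLike.norm_conj, RCLike.mul_conj, ← RCLike.ofReal_pow, RCLike.ofReal_re]
  · rw [inner_self_eq_norm_sq]

lemma rpow_one_sub_mul_rpow {x θ : ℝ} (hx : 0 ≤ x) (h0 : 0 < θ) (h1 : θ < 1) :
    x ^ (1 - θ) * x ^ θ = x := by
  rw [← Real.rpow_add_of_nonneg hx (by linarith) h0.le, sub_add_cancel, Real.rpow_one]

/-- An interpolation inequality between norms which holds coordinatewise, with a uniform constant,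
holds for the norms: Parseval's identity and Hölder's inequality. -/
lemma HilbertBasis.norm_le_of_forall_norm_inner_le {ι 𝕜 H : Type*} [RCLike 𝕜]
    [NormedAddCommGroup H] [InnerProductSpace 𝕜 H] (b : HilbertBasis ι 𝕜 H) {x y z : H} {M θ : ℝ}
    (hM : 0 ≤ M) (h0 : 0 < θ) (h1 : θ < 1)
    (h : ∀ i, ‖inner 𝕜 (b i) y‖ ≤
      M * ‖inner 𝕜 (b i) x‖ ^ (1 - θ) * ‖inner 𝕜 (b i) z‖ ^ θ) :
    ‖y‖ ≤ M * ‖x‖ ^ (1 - θ) * ‖z‖ ^ θ := by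
  have h1' : 0 < 1 - θ := by linarith
  set f : ι → ℝ := fun i => (‖inner 𝕜 (b i) x‖ ^ 2) ^ (1 - θ)
  set g : ι → ℝ := fun i => (‖inner 𝕜 (b i) z‖ ^ 2) ^ θ
  have hf : ∀ i, f i ^ (1 / (1 - θ)) = ‖inner 𝕜 (b i) x‖ ^ 2 := fun i => by
    rw [← Real.rpow_mul (sq_nonneg _), mul_one_div_cancel h1'.ne', Real.rpow_one]
  have hg : ∀ i, g i ^ (1 / θ) = ‖inner 𝕜 (b i) z‖ ^ 2 := fun i => by
    rw [← Real.rpow_mul (sq_nonneg _), mul_one_div_cancel h0.ne', Real.rpow_one]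
  have hpq : (1 / (1 - θ)).HolderConjugate (1 / θ) := by
    rw [Real.holderConjugate_iff]
    refine ⟨(one_lt_div h1').2 (by linarith), ?_⟩
    simp
  have holder := Real.summable_and_inner_le_Lp_mul_Lq_tsum_of_nonneg (f := f) (g := g) hpq
    (fun i => Real.rpow_nonneg (sq_nonneg _) _) (fun i => Real.rpow_nonneg (sq_nonneg _) _)
    (by simpa only [hf] using (b.hasSum_norm_sq x).summable)
    (by simpa only [hg] using (b.hasSum_norm_sq z).summable)
  simp only [hf, hg, (b.hasSum_norm_sq x).tsum_eq, (b.hasSum_norm_sq z).tsum_eq, one_div_one_div]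
    at holder
  have sq_rpow : ∀ (r s : ℝ), 0 ≤ r → (r ^ 2) ^ s = (r ^ s) ^ 2 := fun r s hr => by
    rw [← Real.rpow_natCast_mul hr, ← Real.rpow_mul_natCast hr, mul_comm]
  have le : ‖y‖ ^ 2 ≤ M ^ 2 * ∑' i, f i * g i := by
    rw [← (b.hasSum_norm_sq y).tsum_eq, ← tsum_mul_left]
    refine Summable.tsum_le_tsum (fun i => ?_) (b.hasSum_norm_sq y).summable
      (holder.1.mul_left _)
    have := pow_le_pow_left₀ (norm_nonneg _) (h i) 2
    simp only [f, g, sq_rpow _ _ (norm_nonneg _)]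
    linarith [mul_pow (M * ‖inner 𝕜 (b i) x‖ ^ (1 - θ)) (‖inner 𝕜 (b i) z‖ ^ θ) 2,
      mul_pow M (‖inner 𝕜 (b i) x‖ ^ (1 - θ)) 2]
  refine le_of_sq_le_sq ?_ (by positivity)
  calc ‖y‖ ^ 2 ≤ M ^ 2 * ∑' i, f i * g i := le
    _ ≤ M ^ 2 * ((‖x‖ ^ 2) ^ (1 - θ) * (‖z‖ ^ 2) ^ θ) := by
      gcongr
      exact holder.2
    _ = _ := by
      rw [sq_rpow _ _ (norm_nonneg _), sq_rpow _ _ (norm_nonneg _)]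
      ring

end Interpolation

section Bounds

variable {α : ℝ}

lemma mittagLeffler_one (x : ℝ) : mittagLeffler 1 x = Real.exp x := by
  rw [mittagLeffler, Real.exp_eq_exp_ℝ, NormedSpace.exp_eq_tsum_div]
  simp [Real.Gamma_nat_eq_factorial]

lemma one_le_mittagLeffler (hα : 0 < α) (hα₁ : α ≤ 1) {x : ℝ} (hx : 0 ≤ x) :
    1 ≤ mittagLeffler α x := by
  have := mittagLeffler_mono hα hα₁ le_rfl hx
  rwa [mittagLeffler_zero] at this

/-- The scalar interpolation inequality. For `μ < 0` it is the logarithmic convexity of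
`t ↦ E_α (μ t^α)`; for `μ ≥ 0` this function takes values between `1` and `E_α (κ T^α)`. -/
lemma fractionalExp_bound (hα : 0 < α) (hα₁ : α ≤ 1) {μ κ T t : ℝ} (hκ : 0 ≤ κ) (hμ : μ ≤ κ)
    (ht0 : 0 ≤ t) (htT : t < T) :
    0 ≤ fractionalExp α μ T ∧ 0 ≤ fractionalExp α μ t ∧
      fractionalExp α μ t ≤ mittagLeffler α (κ * T ^ α) * fractionalExp α μ T ^ (t / T) := by
  have hT : 0 < T := lt_of_le_of_lt ht0 htT
  have hM : 1 ≤ mittagLeffler α (κ * T ^ α) := one_le_mittagLeffler hα hα₁ (by positivity)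
  rcases le_or_gt 0 μ with hμ0 | hμ0
  · have one_le : ∀ s, 0 ≤ s → 1 ≤ fractionalExp α μ s := fun s hs => by
      rw [fractionalExp_of_nonneg hs]
      exact one_le_mittagLeffler hα hα₁ (by positivity)
    refine ⟨by linarith [one_le T hT.le], by linarith [one_le t ht0], ?_⟩
    have h1 : fractionalExp α μ t ≤ mittagLeffler α (κ * T ^ α) := by
      rw [fractionalExp_of_nonneg ht0]
      exact mittagLeffler_mono hα hα₁ (by positivity) (by gcongr)
    have h2 := Real.one_le_rpow (one_le T hT.le) (div_nonneg ht0 hT.le)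
    exact h1.trans (le_mul_of_one_le_right (by linarith) h2)
  · obtain ⟨p1, p2, p3⟩ : 0 ≤ fractionalExp α μ T ∧ 0 ≤ fractionalExp α μ t ∧
        fractionalExp α μ t ≤ fractionalExp α μ T ^ (t / T) := by
      rcases hα₁.eq_or_lt with rfl | hα₁
      · rw [fractionalExp_of_nonneg ht0, fractionalExp_of_nonneg hT.le, mittagLeffler_one,
          mittagLeffler_one, Real.rpow_one, Real.rpow_one]
        refine ⟨(Real.exp_pos _).le, (Real.exp_pos _).le, ?_⟩
        rw [← Real.exp_mul, mul_assoc, mul_div_cancel₀ _ hT.ne']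
      · have hw := isRelaxation_fractionalExp hα hα₁ (-μ)
        have hl : 0 < -μ * Real.Gamma (1 - α) / α :=
          div_pos (mul_pos (neg_pos.2 hμ0) (Real.Gamma_pos_of_pos (sub_pos.2 hα₁))) hα
        rw [neg_neg] at hw
        exact ⟨(hw.pos hl T).le, (hw.pos hl t).le, hw.le_rpow hl (by linarith)
          (fun s hs => (hasDerivAt_fractionalExp hα hα₁.le hs).differentiableAt) hT ⟨ht0, htT.le⟩⟩
    refine ⟨p1, p2, p3.trans (le_mul_of_one_le_left (Real.rpow_nonneg p1 _) hM)⟩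

/-- The interpolation inequality, with the constant `E_α (κ T^α)`. -/
lemma IsFractionalSolution.norm_le {𝕜 H : Type*} [RCLike 𝕜] [NormedAddCommGroup H]
    [InnerProductSpace 𝕜 H] [CompleteSpace H] {T κ : ℝ} (hα₀ : 0 < α) (hα₁ : α ≤ 1)
    (hT : 0 < T) (hκ : 0 ≤ κ) {A : H →ₗ.[𝕜] H} (hA : IsSelfAdjoint A)
    (hbound : ∀ x : A.domain, RCLike.re (inner 𝕜 (A x) (x : H)) ≤ κ * ‖(x : H)‖ ^ 2)
    (hcompact : HasCompactResolvent A) {u₀ : H} {u : ℝ → H} (hu : IsFractionalSolution α T A u₀ u)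
    {t : ℝ} (ht : t ∈ Icc 0 T) :
    ‖u t‖ ≤ mittagLeffler α (κ * T ^ α) * ‖u₀‖ ^ (1 - t / T) * ‖u T‖ ^ (t / T) := by
  have hM : 1 ≤ mittagLeffler α (κ * T ^ α) := one_le_mittagLeffler hα₀ hα₁ (by positivity)
  rcases ht.1.eq_or_lt with rfl | ht0
  · simpa [hu.initial] using le_mul_of_one_le_left (norm_nonneg u₀) hM
  rcases ht.2.eq_or_lt with rfl | htT
  · simpa [div_self hT.ne'] using le_mul_of_one_le_left (norm_nonneg (u t)) hM
  obtain ⟨ι, b, μ, hb⟩ := exists_hilbertBasis_eigenvectors hA hbound hcompact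
  have hθ0 : 0 < t / T := div_pos ht0 hT
  have hθ1 : t / T < 1 := (div_lt_one hT).2 htT
  refine b.norm_le_of_forall_norm_inner_le (by linarith) hθ0 hθ1 fun i => ?_
  obtain ⟨hμ, hdom, hAb⟩ := hb i
  have coord := eq_fractionalExp_smul hα₀ hα₁ (μ := μ i) hT (g := fun s => inner 𝕜 (b i) (u s))
    (continuousOn_const.inner hu.continuousOn) (hu.absolutelyContinuous ⟨b i, hdom⟩) (by
      filter_upwards [hu.equation ⟨b i, hdom⟩] with s hs hsT
      rw [hs hsT, hAb, inner_smul_left, RCLike.conj_ofReal, RCLike.real_smul_eq_coe_mul])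
  obtain ⟨p1, p2, p3⟩ := fractionalExp_bound hα₀ hα₁ hκ hμ ht0.le htT
  have c1 := coord t ht
  have c2 := coord T (right_mem_Icc.2 hT.le)
  simp only [hu.initial] at c1 c2
  rw [c1, c2, norm_smul, norm_smul, Real.norm_of_nonneg p1, Real.norm_of_nonneg p2,
    Real.mul_rpow p1 (norm_nonneg _)]
  nth_rewrite 1 [← rpow_one_sub_mul_rpow (norm_nonneg (inner 𝕜 (b i) u₀)) hθ0 hθ1]
  calc _ ≤ (mittagLeffler α (κ * T ^ α) * fractionalExp α (μ i) T ^ (t / T)) * _ := by gcongr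
    _ = _ := by ring

end Bounds

theorem theorem5 {𝕜 H : Type*} [RCLike 𝕜] [NormedAddCommGroup H] [InnerProductSpace 𝕜 H]
    [CompleteSpace H] (α T κ : ℝ) (hα₀ : 0 < α) (hα₁ : α ≤ 1) (hT : 0 < T) (hκ : 0 ≤ κ)
    (A : H →ₗ.[𝕜] H) (hA : IsSelfAdjoint A)
    (hbound : ∀ x : A.domain, RCLike.re (inner 𝕜 (A x) (x : H)) ≤ κ * ‖(x : H)‖ ^ 2)
    (hcompact : HasCompactResolvent A) :
    (∃ M : ℝ, 1 ≤ M ∧ ∀ (u₀ : H) (u : ℝ → H), IsFractionalSolution α T A u₀ u →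
      ∀ t ∈ Set.Icc 0 T, ‖u t‖ ≤ M * ‖u₀‖ ^ (1 - t / T) * ‖u T‖ ^ (t / T)) ∧
    (κ = 0 → ∀ (u₀ : H) (u : ℝ → H), IsFractionalSolution α T A u₀ u →
      ∀ t ∈ Set.Icc 0 T, ‖u t‖ ≤ ‖u₀‖ ^ (1 - t / T) * ‖u T‖ ^ (t / T)) := by
  refine ⟨⟨mittagLeffler α (κ * T ^ α), one_le_mittagLeffler hα₀ hα₁ (by positivity),
    fun u₀ u hu t ht => hu.norm_le hα₀ hα₁ hT hκ hA hbound hcompact ht⟩, fun h0 u₀ u hu t ht => ?_⟩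
  have := hu.norm_le hα₀ hα₁ hT hκ hA hbound hcompact ht
  rwa [h0, zero_mul, mittagLeffler_zero, one_mul] at this
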